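/- Let $W$ be a standard two-sided Brownian motion on a probability space with measure $P$, let $\rho:\mathbb R\to\mathbb R$ be measurable, and suppose that $\int_{\mathbb R}(1+|x|)^m e^{-2x}\rho^2(x)\,dx<\infty$ for some $m>4$. For $n\ge 1$ and $u\in\mathbb R$ put $$\Phi_n(u):=\Phi_n^{(0)}(u):=n^{-1/2}\,u(u-i)\int e^{iux-x}\rho(x)\,dW(x),$$ $$\Phi_n^{(1)}(u):=n^{-1/2}\int e^{iux-x}\big(2u-i+(iu^2+u)x\big)\rho(x)\,dW(x),$$ $$\Phi_n^{(2)}(u):=n^{-1/2}\int e^{iux-x}\big(2+2(2iu+1)x+u(i-u)x^2\big)\rho(x)\,dW(x),$$ where the integrals are Wiener integrals with respect to $W$. Then all these Wiener integrals exist, and $\Phi_n$ is twice $L^2(P)$-differentiable on $\mathbb R$, with first derivative $\Phi_n^{(1)}$ and second derivative $\Phi_n^{(2)}$; that is, for $k=0,1$ and every $u\in\mathbb R$, $h^{-1}\big(\Phi_n^{(k)}(u+h)-\Phi_n^{(k)}(u)\big)\to\Phi_n^{(k+1)}(u)$ in $L^2(P)$ as $h\to0$. Moreover, for $k=0,1,2$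 the process $\Phi_n^{(k)}$ has a version with almost surely continuous paths (again denoted by $\Phi_n^{(k)}$) whose suprema $\sup_{|u|\le U}|\Phi_n^{(k)}(u)|$, $U>0$, are random variables satisfying the following bound: for every $U_0>1$ there is a constant $C$, depending only on $\rho$ and $U_0$, such that for all $n\ge1$ and all $U\ge U_0$ $$\mathbb E\Big[\sup_{u\in[-U,U]}|\Phi_n^{(k)}(u)|\Big]\le C\,n^{-1/2}\,U^2\sqrt{\log U}.$$ -/

import Mathlib

open MeasureTheory ProbabilityTheory Filter Topology Set
open scoped ENNReal NNReal

noncomputable section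

/-- `W` is a standard two-sided Brownian motion (indexed by the whole real line) under `P`:
it starts at `0`, has independent increments, `W t - W s` is centered Gaussian with variance
`|t - s|`, and almost all paths are continuous. -/
structure IsTwoSidedBrownianMotion {Ω : Type*} [MeasurableSpace Ω] (P : Measure Ω)
    (W : ℝ → Ω → ℝ) : Prop where
  zero : ∀ᵐ ω ∂P, W 0 ω = 0
  indep : HasIndepIncrements W P
  law : ∀ s t : ℝ, HasLaw (W t - W s) (gaussianReal 0 (nndist s t)) P
  cont : ∀ᵐ ω ∂P, Continuous fun t => W t ω

/-- Complex step functions on the real line, given as formal finite combinations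
`∑ c_j • 1_(a_j, b_j]` with `a_j ≤ b_j`. -/
abbrev StepFun : Type := NonemptyInterval ℝ →₀ ℂ

/-- The step function `x ↦ ∑ c_j 1_(a_j, b_j](x)`. -/
def StepFun.eval (g : StepFun) (x : ℝ) : ℂ :=
  g.sum fun I c => (Ioc I.fst I.snd).indicator (fun _ => c) x

/-- The elementary integral `∑ c_j (W(b_j) - W(a_j))` of a step function. -/
def StepFun.integral {Ω : Type*} (g : StepFun) (W : ℝ → Ω → ℝ) (ω : Ω) : ℂ :=
  g.sum fun I c => c * ((W I.snd ω - W I.fst ω : ℝ) : ℂ)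

/-- `J` is (a version of) the Wiener integral `∫ f dW` of `f ∈ L²(ℝ)`: the `L²(P)`-limit of the
elementary integrals of step functions which converge to `f` in `L²(ℝ)`. -/
def IsWienerIntegral {Ω : Type*} [MeasurableSpace Ω] (P : Measure Ω) (W : ℝ → Ω → ℝ)
    (f : ℝ → ℂ) (J : Ω → ℂ) : Prop :=
  MemLp f 2 volume ∧ MemLp J 2 P ∧
    ∃ g : ℕ → StepFun,
      Tendsto (fun j => eLpNorm (fun x => (g j).eval x - f x) 2 volume) atTop (𝓝 0) ∧
      Tendsto (fun j => eLpNorm (fun ω => (g j).integral W ω - J ω) 2 P) atTop (𝓝 0)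

open Classical in
/-- The Wiener integral `∫ f dW`, determined up to almost sure equality
(with value `0` if it does not exist). -/
def wienerIntegral {Ω : Type*} [MeasurableSpace Ω] (P : Measure Ω) (W : ℝ → Ω → ℝ)
    (f : ℝ → ℂ) : Ω → ℂ :=
  if h : ∃ J, IsWienerIntegral P W f J then h.choose else 0

/-- `X : ℝ → Ω → ℂ` is `L²(P)`-differentiable with derivative `Y`: all `X u` and `Y u` are in
`L²(P)`, and `(X (u + h) - X u) / h → Y u` in `L²(P)` as `h → 0`, for every `u`. -/
def HasL2Deriv {Ω : Type*} [MeasurableSpace Ω] (P : Measure Ω) (X Y : ℝ → Ω → ℂ) : Prop :=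
  ∀ u : ℝ, MemLp (X u) 2 P ∧ MemLp (Y u) 2 P ∧
    Tendsto (fun h : ℝ => eLpNorm (fun ω => (X (u + h) ω - X u ω) / (h : ℂ) - Y u ω) 2 P)
      (𝓝[≠] 0) (𝓝 0)

/-- The deterministic integrands
`e^{iux-x} ρ(x)`, `e^{iux-x} (2u - i + (iu² + u) x) ρ(x)` and
`e^{iux-x} (2 + 2(2iu + 1) x + u(i - u) x²) ρ(x)`. -/
def noiseIntegrand (ρ : ℝ → ℝ) (k : Fin 3) (u x : ℝ) : ℂ :=
  Complex.exp (Complex.I * u * x - x) *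
    (match k with
      | 0 => 1
      | 1 => 2 * u - Complex.I + (Complex.I * u ^ 2 + u) * x
      | 2 => 2 + 2 * (2 * Complex.I * u + 1) * x + u * (Complex.I - u) * x ^ 2) * (ρ x : ℂ)

/-- The processes `Φ_n^{(0)} = Φ_n`, `Φ_n^{(1)}` and `Φ_n^{(2)}`, where
`Φ_n(u) = n^{-1/2} u (u - i) ∫ e^{iux-x} ρ(x) dW(x)` and the other two are `n^{-1/2}` times the
Wiener integrals of the respective integrands. -/
def errorProcess {Ω : Type*} [MeasurableSpace Ω] (P : Measure Ω) (W : ℝ → Ω → ℝ) (ρ : ℝ → ℝ)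
    (n : ℕ) (k : Fin 3) (u : ℝ) (ω : Ω) : ℂ :=
  (((n : ℝ) ^ (-(1 / 2) : ℝ) : ℝ) : ℂ) * (if k = 0 then u * (u - Complex.I) else 1) *
    wienerIntegral P W (noiseIntegrand ρ k u) ω

end

/-- The squared modulus of a complex combination of real numbers is a quadratic form. -/
lemma norm_sq_sum_mul_ofReal {ι : Type*} (s : Finset ι) (c : ι → ℂ) (z : ι → ℝ) :
    ‖∑ i ∈ s, c i * (z i : ℂ)‖ ^ 2 =
      ∑ i ∈ s, ∑ j ∈ s, ((c i).re * (c j).re + (c i).im * (c j).im) * (z i * z j) := by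
  rw [Complex.sq_norm, Complex.normSq_apply, Complex.re_sum, Complex.im_sum,
    Finset.sum_mul_sum, Finset.sum_mul_sum, ← Finset.sum_add_distrib]
  refine Finset.sum_congr rfl fun i _ => ?_
  rw [← Finset.sum_add_distrib]
  refine Finset.sum_congr rfl fun j _ => ?_
  simp
  ring

lemma eLpNorm_two_sq {α : Type*} [MeasurableSpace α] {μ : Measure α} (f : α → ℂ) :
    eLpNorm f 2 μ ^ 2 = ∫⁻ x, ENNReal.ofReal (‖f x‖ ^ 2) ∂μ := by
  rw [eLpNorm_eq_lintegral_rpow_enorm_toReal (by simp) (by simp)]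
  rw [← ENNReal.rpow_natCast, ← ENNReal.rpow_mul]
  simp only [ENNReal.toReal_ofNat, Nat.cast_ofNat]
  norm_num

lemma eLpNorm_sum_mul_ofReal_sq {ι α : Type*} [MeasurableSpace α] {μ : Measure α}
    (s : Finset ι) (c : ι → ℂ) (v : ι → α → ℝ) (hv : ∀ i, MemLp (v i) 2 μ) :
    eLpNorm (fun x => ∑ i ∈ s, c i * (v i x : ℂ)) 2 μ ^ 2 =
      ENNReal.ofReal (∑ i ∈ s, ∑ j ∈ s, ((c i).re * (c j).re + (c i).im * (c j).im) *
        ∫ x, v i x * v j x ∂μ) := by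
  rw [eLpNorm_two_sq]
  simp_rw [norm_sq_sum_mul_ofReal]
  have hi : ∀ i j, Integrable (fun x => v i x * v j x) μ := fun i j =>
    (hv i).integrable_mul (hv j)
  rw [← ofReal_integral_eq_lintegral_ofReal]
  · rw [integral_finsetSum _ fun i _ => integrable_finsetSum _ fun j _ => (hi i j).const_mul _]
    congr 1
    refine Finset.sum_congr rfl fun i _ => ?_
    rw [integral_finsetSum _ fun j _ => (hi i j).const_mul _]
    simp_rw [integral_const_mul]
  · exact integrable_finsetSum _ fun i _ => integrable_finsetSum _ fun j _ =>
      (hi i j).const_mul _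
  · refine .of_forall fun x => ?_
    simp_rw [← norm_sq_sum_mul_ofReal]
    positivity

/-- Families of real square-integrable functions with the same Gram matrix give the same
`L²`-norms to all complex combinations. -/
lemma eLpNorm_sum_mul_ofReal_congr {ι α β : Type*} [MeasurableSpace α] [MeasurableSpace β]
    {μ : Measure α} {ν : Measure β} (s : Finset ι) (c : ι → ℂ) (z : ι → α → ℝ) (w : ι → β → ℝ)
    (hz : ∀ i, MemLp (z i) 2 μ) (hw : ∀ i, MemLp (w i) 2 ν)
    (h : ∀ i j, ∫ x, z i x * z j x ∂μ = ∫ x, w i x * w j x ∂ν) :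
    eLpNorm (fun x => ∑ i ∈ s, c i * (z i x : ℂ)) 2 μ =
      eLpNorm (fun x => ∑ i ∈ s, c i * (w i x : ℂ)) 2 ν := by
  apply (ENNReal.pow_right_strictMono two_ne_zero).injective
  simp_rw [eLpNorm_sum_mul_ofReal_sq s c z hz, eLpNorm_sum_mul_ofReal_sq s c w hw, h]

namespace StepFun

lemma eval_eq_sum (g : StepFun) (x : ℝ) :
    g.eval x = ∑ I ∈ g.support, g I * (((Ioc I.fst I.snd).indicator 1 x : ℝ) : ℂ) := by
  unfold eval Finsupp.sum
  refine Finset.sum_congr rfl fun I _ => ?_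
  by_cases h : x ∈ Ioc I.fst I.snd <;> simp [h]

lemma integral_eq_sum {Ω : Type*} (g : StepFun) (W : ℝ → Ω → ℝ) (ω : Ω) :
    g.integral W ω = ∑ I ∈ g.support, g I * (((W I.snd - W I.fst) ω : ℝ) : ℂ) := rfl

lemma eval_add (g h : StepFun) : (g + h).eval = g.eval + h.eval := by
  ext x
  simp only [Pi.add_apply]
  exact Finsupp.sum_add_index' (by simp) (by intro a b c; simp [indicator_add])

lemma eval_smul (c : ℂ) (g : StepFun) : (c • g : StepFun).eval = fun x => c * g.eval x := by
  ext x
  unfold eval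
  rw [Finsupp.sum_smul_index' (by simp), Finsupp.mul_sum]
  refine Finset.sum_congr rfl fun I _ => ?_
  by_cases h : x ∈ Ioc I.fst I.snd <;> simp [h]

lemma integral_add {Ω : Type*} (g h : StepFun) (W : ℝ → Ω → ℝ) :
    (g + h).integral W = g.integral W + h.integral W := by
  ext ω
  simp only [Pi.add_apply]
  exact Finsupp.sum_add_index' (by simp) (by intro a b c; ring)

lemma integral_smul {Ω : Type*} (c : ℂ) (g : StepFun) (W : ℝ → Ω → ℝ) :
    (c • g : StepFun).integral W = fun ω => c * g.integral W ω := by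
  ext ω
  unfold integral
  rw [Finsupp.sum_smul_index' (by simp), Finsupp.mul_sum]
  exact Finset.sum_congr rfl fun I _ => by simp [mul_assoc]

lemma eval_sub (g h : StepFun) : (g - h).eval = g.eval - h.eval := by
  have : g - h = g + (-1 : ℂ) • h := by rw [neg_one_smul]; abel
  rw [this, eval_add, eval_smul]
  ext x; simp [sub_eq_add_neg]

lemma integral_sub {Ω : Type*} (g h : StepFun) (W : ℝ → Ω → ℝ) :
    (g - h).integral W = g.integral W - h.integral W := by
  have : g - h = g + (-1 : ℂ) • h := by rw [neg_one_smul]; abel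
  rw [this, integral_add, integral_smul]
  ext x; simp [sub_eq_add_neg]

lemma memLp_indicator (I : NonemptyInterval ℝ) :
    MemLp ((Ioc I.fst I.snd).indicator (1 : ℝ → ℝ)) 2 volume :=
  memLp_indicator_const 2 measurableSet_Ioc (1 : ℝ) (.inr (by simp))

lemma memLp_eval (g : StepFun) : MemLp g.eval 2 volume := by
  have : g.eval = fun x => ∑ I ∈ g.support,
      g I * (((Ioc I.fst I.snd).indicator 1 x : ℝ) : ℂ) := by
    ext x; exact g.eval_eq_sum x
  rw [this]
  exact memLp_finsetSum _ fun I _ => ((memLp_indicator I).ofReal).const_mul _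

end StepFun

namespace IsTwoSidedBrownianMotion

variable {Ω : Type*} [MeasurableSpace Ω] {P : Measure Ω} {W : ℝ → Ω → ℝ}

lemma hasGaussianLaw_sub (hW : IsTwoSidedBrownianMotion P W) (s t : ℝ) :
    HasGaussianLaw (W t - W s) P := (hW.law s t).hasGaussianLaw

lemma memLp_sub (hW : IsTwoSidedBrownianMotion P W) (s t : ℝ) :
    MemLp (W t - W s) 2 P := (hW.hasGaussianLaw_sub s t).memLp_two

lemma integral_sub (hW : IsTwoSidedBrownianMotion P W) (s t : ℝ) :
    ∫ ω, (W t - W s) ω ∂P = 0 := by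
  rw [(hW.law s t).integral_eq]; simp

lemma integral_sub_sq (hW : IsTwoSidedBrownianMotion P W) (s t : ℝ) :
    ∫ ω, ((W t - W s) ω) ^ 2 ∂P = |s - t| := by
  have := (hW.law s t).variance_eq
  rw [variance_of_integral_eq_zero (hW.memLp_sub s t).aestronglyMeasurable.aemeasurable
    (hW.integral_sub s t)] at this
  simp only [variance_id_gaussianReal, coe_nndist, Real.dist_eq] at this
  exact this

lemma integral_sub_mul_sub (hW : IsTwoSidedBrownianMotion P W) (a b c d : ℝ) :
    ∫ ω, (W b - W a) ω * (W d - W c) ω ∂P =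
      (|b - c| + |a - d| - |b - d| - |a - c|) / 2 := by
  have h : ∀ ω, (W b - W a) ω * (W d - W c) ω = (((W c - W b) ω) ^ 2 + ((W d - W a) ω) ^ 2
      - ((W d - W b) ω) ^ 2 - ((W c - W a) ω) ^ 2) / 2 := by
    intro ω; simp only [Pi.sub_apply]; ring
  simp_rw [h]
  have hi : ∀ s t, Integrable (fun ω => ((W t - W s) ω) ^ 2) P := fun s t =>
    (hW.memLp_sub s t).integrable_sq
  rw [integral_div,
    MeasureTheory.integral_sub (by exact ((hi _ _).add (hi _ _)).sub (hi _ _)) (by exact hi _ _),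
    MeasureTheory.integral_sub (by exact (hi _ _).add (hi _ _)) (by exact hi _ _),
    MeasureTheory.integral_add (by exact hi _ _) (by exact hi _ _)]
  simp_rw [hW.integral_sub_sq]

lemma integral_sub_mul_sub_eq (hW : IsTwoSidedBrownianMotion P W) (I J : NonemptyInterval ℝ) :
    ∫ ω, (W I.snd - W I.fst) ω * (W J.snd - W J.fst) ω ∂P =
      ∫ x, (Ioc I.fst I.snd).indicator (1 : ℝ → ℝ) x * (Ioc J.fst J.snd).indicator 1 x := by
  rw [hW.integral_sub_mul_sub]
  have : (fun x => (Ioc I.fst I.snd).indicator (1 : ℝ → ℝ) x * (Ioc J.fst J.snd).indicator 1 x) =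
      (Ioc (I.fst ⊔ J.fst) (I.snd ⊓ J.snd)).indicator 1 := by
    ext x
    rw [← Ioc_inter_Ioc, inter_indicator_one]; rfl
  rw [this, integral_indicator_one measurableSet_Ioc, Measure.real, Real.volume_Ioc]
  have hI := I.fst_le_snd
  have hJ := J.fst_le_snd
  rw [ENNReal.toReal_ofReal']
  rcases abs_cases (I.snd - J.fst) with h1 | h1 <;> rcases abs_cases (I.fst - J.snd) with h2 | h2 <;>
  rcases abs_cases (I.snd - J.snd) with h3 | h3 <;> rcases abs_cases (I.fst - J.fst) with h4 | h4 <;>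
  grind

/-- The Itô isometry for step functions. -/
lemma eLpNorm_integral (hW : IsTwoSidedBrownianMotion P W) (g : StepFun) :
    eLpNorm (g.integral W) 2 P = eLpNorm g.eval 2 volume := by
  have : g.eval = fun x => ∑ I ∈ g.support,
      g I * (((Ioc I.fst I.snd).indicator 1 x : ℝ) : ℂ) := by
    ext x; exact g.eval_eq_sum x
  rw [this]
  exact eLpNorm_sum_mul_ofReal_congr g.support g (fun I => W I.snd - W I.fst)
    (fun I => (Ioc I.fst I.snd).indicator 1) (fun I => hW.memLp_sub _ _)
    StepFun.memLp_indicator hW.integral_sub_mul_sub_eq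

lemma memLp_integral (hW : IsTwoSidedBrownianMotion P W) (g : StepFun) :
    MemLp (g.integral W) 2 P := by
  have : g.integral W = fun ω => ∑ I ∈ g.support,
      g I * (((W I.snd - W I.fst) ω : ℝ) : ℂ) := by
    ext x; exact g.integral_eq_sum W x
  rw [this]
  exact memLp_finsetSum _ fun I _ => ((hW.memLp_sub _ _).ofReal).const_mul _

end IsTwoSidedBrownianMotion

namespace StepFun

/-- The step function with value `h (a + j / n)` on the `j`-th interval of length `1 / n` to the
right of `a`. -/
noncomputable def sample (h : ℝ → ℂ) (a : ℝ) (n M : ℕ) : StepFun :=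
  ∑ j ∈ Finset.range M, Finsupp.single
    (⟨(a + j / n, a + (j + 1) / n), by dsimp only; gcongr; linarith⟩ : NonemptyInterval ℝ)
    (h (a + j / n))

lemma eval_sample (h : ℝ → ℂ) (a : ℝ) (n M : ℕ) (x : ℝ) :
    (sample h a n M).eval x = ∑ j ∈ Finset.range M,
      (Ioc (a + j / n) (a + (j + 1) / n)).indicator (fun _ => h (a + j / n)) x := by
  let F : StepFun →+ ℂ :=
    { toFun := fun g => g.eval x
      map_zero' := Finsupp.sum_zero_index
      map_add' := fun g h => by rw [eval_add]; rfl }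
  change F _ = _
  rw [sample, map_sum]
  refine Finset.sum_congr rfl fun j _ => ?_
  exact Finsupp.sum_single_index
    (h := fun I : NonemptyInterval ℝ => fun c : ℂ => (Ioc I.fst I.snd).indicator (fun _ => c) x)
    (by simp)

lemma eval_sample_of_le (h : ℝ → ℂ) (a : ℝ) (n M : ℕ) {x : ℝ} (hx : x ≤ a) :
    (sample h a n M).eval x = 0 := by
  rw [eval_sample]
  refine Finset.sum_eq_zero fun j _ => indicator_of_notMem ?_ _
  intro hj
  have : (0 : ℝ) ≤ j / n := by positivity
  linarith [hj.1]

lemma eval_sample_of_lt (h : ℝ → ℂ) (a : ℝ) {n : ℕ} (hn : 0 < n) (M : ℕ) {x : ℝ}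
    (hx : a + M / n < x) : (sample h a n M).eval x = 0 := by
  rw [eval_sample]
  refine Finset.sum_eq_zero fun j hj => indicator_of_notMem ?_ _
  intro hj'
  have h1 : (j : ℝ) + 1 ≤ M := by exact_mod_cast Finset.mem_range.1 hj
  have : ((j : ℝ) + 1) / n ≤ M / n := by gcongr
  linarith [hj'.2]

lemma exists_eval_sample (h : ℝ → ℂ) (a : ℝ) {n : ℕ} (hn : 0 < n) (M : ℕ) {x : ℝ}
    (hx : x ∈ Ioc a (a + M / n)) :
    ∃ y, |x - y| ≤ 1 / n ∧ (sample h a n M).eval x = h y := by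
  have hn' : (0 : ℝ) < n := by exact_mod_cast hn
  set t := (x - a) * n with ht
  have hxt : x = a + t / n := by rw [ht]; field_simp; ring
  have ht0 : 0 < t := mul_pos (by linarith [hx.1]) hn'
  have htM : t ≤ M := by
    have := hx.2
    rw [hxt] at this
    have : t / n ≤ M / n := by linarith
    rwa [div_le_div_iff_of_pos_right hn'] at this
  obtain ⟨k, hk⟩ : ∃ k : ℕ, ⌈t⌉₊ = k + 1 :=
    Nat.exists_eq_succ_of_ne_zero (Nat.ceil_pos.2 ht0).ne'
  have hk1 : (k : ℝ) < t := Nat.lt_ceil.1 (by omega)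
  have hk2 : t ≤ k + 1 := by have := Nat.le_ceil t; rw [hk] at this; exact_mod_cast this
  have hkM : k < M := by
    have : ⌈t⌉₊ ≤ M := Nat.ceil_le.2 htM
    omega
  refine ⟨a + k / n, ?_, ?_⟩
  · rw [hxt, show a + t / n - (a + k / n) = (t - k) / n by ring, abs_of_nonneg (by
      apply div_nonneg <;> linarith)]
    gcongr; linarith
  · rw [eval_sample, Finset.sum_eq_single k]
    · rw [indicator_of_mem]
      rw [hxt]
      constructor <;> gcongr
    · intro j _ hjk
      refine indicator_of_notMem ?_ _
      rintro ⟨h1, h2⟩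
      rw [hxt] at h1 h2
      have h1 : (j : ℝ) / n < t / n := by linarith
      have h2 : t / n ≤ (j + 1) / n := by linarith
      rw [div_lt_div_iff_of_pos_right hn'] at h1
      rw [div_le_div_iff_of_pos_right hn'] at h2
      apply hjk
      have h3 : (j : ℝ) < k + 1 := by linarith
      have h4 : (k : ℝ) < j + 1 := by linarith
      have h3 : j < k + 1 := by exact_mod_cast h3
      have h4 : k < j + 1 := by exact_mod_cast h4
      omega
    · intro hk; exact absurd (Finset.mem_range.2 hkM) hk

lemma exists_eLpNorm_sub_le_of_continuous {h : ℝ → ℂ} (hc : Continuous h)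
    (hs : HasCompactSupport h) {ε : ℝ≥0∞} (hε : ε ≠ 0) :
    ∃ g : StepFun, eLpNorm (g.eval - h) 2 volume ≤ ε := by
  obtain ⟨R, hR⟩ := hs.isCompact.isBounded.subset_closedBall 0
  obtain ⟨N, hN⟩ := exists_nat_gt R
  have hsupp : ∀ x : ℝ, (x ≤ -N ∨ N < x) → h x = 0 := by
    intro x hx
    refine image_eq_zero_of_notMem_tsupport fun hmem => ?_
    have := hR hmem
    rw [mem_closedBall_zero_iff, Real.norm_eq_abs, abs_le] at this
    rcases hx with hx | hx <;> linarith
  obtain ⟨δ, hδ, hδε⟩ := ENNReal.exists_nnreal_pos_mul_lt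
    (a := volume (Ioc (-N : ℝ) N) ^ (1 / (2 : ℝ≥0∞).toReal)) (b := ε)
    (ENNReal.rpow_ne_top_of_nonneg (by simp) (by simp)) hε
  obtain ⟨η, hη, hu⟩ := Metric.uniformContinuous_iff.1
    (hs.uniformContinuous_of_continuous hc) δ hδ
  obtain ⟨m, hm⟩ := exists_nat_one_div_lt hη
  refine ⟨sample h (-N) (m + 1) (2 * N * (m + 1)), ?_⟩
  have hend : (-N : ℝ) + ((2 * N * (m + 1) : ℕ) : ℝ) / ((m + 1 : ℕ) : ℝ) = N := by
    push_cast; field_simp; ring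
  refine le_trans ?_ (hδε.le)
  refine le_trans (eLpNorm_mono (g := (Ioc (-N : ℝ) N).indicator fun _ => (δ : ℝ)) fun x => ?_)
    (le_trans (eLpNorm_indicator_const_le _ _) (le_of_eq ?_))
  · by_cases hx : x ∈ Ioc (-N : ℝ) N
    · rw [indicator_of_mem hx]
      obtain ⟨y, hy, he⟩ := exists_eval_sample h (-N) m.succ_pos (2 * N * (m + 1)) (x := x)
        (by rw [hend]; exact hx)
      rw [Pi.sub_apply, he]
      have : dist y x < η := by
        rw [dist_comm, Real.dist_eq]
        refine hy.trans_lt ?_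
        exact_mod_cast hm
      have := (hu this).le
      rw [dist_eq_norm] at this
      simpa using this
    · rw [indicator_of_notMem hx, Pi.sub_apply]
      rw [mem_Ioc, not_and_or, not_lt, not_le] at hx
      rw [hsupp x hx]
      rcases hx with hx | hx
      · rw [eval_sample_of_le _ _ _ _ hx]; simp
      · rw [eval_sample_of_lt _ _ m.succ_pos _ (by rwa [hend])]; simp
  · simp

/-- Step functions are dense in `L²(ℝ)`. -/
lemma exists_eLpNorm_sub_le {f : ℝ → ℂ} (hf : MemLp f 2 volume) {ε : ℝ≥0∞} (hε : ε ≠ 0) :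
    ∃ g : StepFun, eLpNorm (g.eval - f) 2 volume ≤ ε := by
  have hε2 : ε / 2 ≠ 0 := by simpa using hε
  obtain ⟨h, hs, hfh, hc, hm⟩ := hf.exists_hasCompactSupport_eLpNorm_sub_le (by simp) hε2
  obtain ⟨g, hg⟩ := exists_eLpNorm_sub_le_of_continuous hc hs hε2
  refine ⟨g, ?_⟩
  rw [show g.eval - f = (g.eval - h) + (h - f) by abel, ← ENNReal.add_halves ε]
  refine (eLpNorm_add_le (g.memLp_eval.sub hm).aestronglyMeasurable
    (hm.sub hf).aestronglyMeasurable (by norm_num)).trans (add_le_add hg ?_)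
  rwa [eLpNorm_sub_comm]

end StepFun

section WienerIntegral

variable {Ω : Type*} [MeasurableSpace Ω] {P : Measure Ω} {W : ℝ → Ω → ℝ} {f f' : ℝ → ℂ}
  {J J' : Ω → ℂ}

lemma tendsto_eLpNorm_of_tendsto_sub {α : Type*} [MeasurableSpace α] {μ : Measure α}
    {F : ℕ → α → ℂ} {G : α → ℂ} (hF : ∀ j, MemLp (F j) 2 μ) (hG : MemLp G 2 μ)
    (h : Tendsto (fun j => eLpNorm (fun x => F j x - G x) 2 μ) atTop (𝓝 0)) :
    Tendsto (fun j => eLpNorm (F j) 2 μ) atTop (𝓝 (eLpNorm G 2 μ)) := by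
  have key : Tendsto (fun j => (hF j).toLp (F j)) atTop (𝓝 (hG.toLp G)) := by
    rw [Lp.tendsto_Lp_iff_tendsto_eLpNorm'']
    exact h
  have := (continuous_enorm.tendsto _).comp key
  simpa [Function.comp_def, Lp.enorm_toLp] using this

namespace IsWienerIntegral

/-- The Itô isometry. -/
lemma eLpNorm_eq (hW : IsTwoSidedBrownianMotion P W) (h : IsWienerIntegral P W f J) :
    eLpNorm J 2 P = eLpNorm f 2 volume := by
  obtain ⟨hf, hJ, g, hg1, hg2⟩ := h
  refine tendsto_nhds_unique (tendsto_eLpNorm_of_tendsto_sub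
    (fun j => hW.memLp_integral (g j)) hJ hg2) ?_
  simp_rw [hW.eLpNorm_integral]
  exact tendsto_eLpNorm_of_tendsto_sub (fun j => (g j).memLp_eval) hf hg1

lemma add (hW : IsTwoSidedBrownianMotion P W) (h : IsWienerIntegral P W f J)
    (h' : IsWienerIntegral P W f' J') :
    IsWienerIntegral P W (f + f') (J + J') := by
  obtain ⟨hf, hJ, g, hg1, hg2⟩ := h
  obtain ⟨hf', hJ', g', hg1', hg2'⟩ := h'
  refine ⟨hf.add hf', hJ.add hJ', fun j => g j + g' j, ?_, ?_⟩
  · refine tendsto_of_tendsto_of_tendsto_of_le_of_le tendsto_const_nhds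
      (by simpa using hg1.add hg1') (fun _ => zero_le) fun j => ?_
    refine le_trans (le_of_eq ?_) (eLpNorm_add_le ((g j).memLp_eval.sub hf).aestronglyMeasurable
      ((g' j).memLp_eval.sub hf').aestronglyMeasurable (by norm_num))
    congr 1; ext x; simp [StepFun.eval_add]; ring
  · refine tendsto_of_tendsto_of_tendsto_of_le_of_le tendsto_const_nhds
      (by simpa using hg2.add hg2') (fun _ => zero_le) fun j => ?_
    refine le_trans (le_of_eq ?_) (eLpNorm_add_le
      ((hW.memLp_integral (g j)).sub hJ).aestronglyMeasurable
      ((hW.memLp_integral (g' j)).sub hJ').aestronglyMeasurable (by norm_num))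
    congr 1; ext x; simp [StepFun.integral_add]; ring

lemma const_mul (c : ℂ) (h : IsWienerIntegral P W f J) :
    IsWienerIntegral P W (fun x => c * f x) (fun ω => c * J ω) := by
  obtain ⟨hf, hJ, g, hg1, hg2⟩ := h
  refine ⟨hf.const_mul c, hJ.const_mul c, fun j => c • g j, ?_, ?_⟩
  · have := ENNReal.Tendsto.const_mul (a := ‖c‖ₑ) hg1 (.inr (by simp))
    rw [mul_zero] at this
    refine this.congr fun j => ?_
    rw [← eLpNorm_const_smul]
    congr 1; ext x; simp [StepFun.eval_smul]; ring
  · have := ENNReal.Tendsto.const_mul (a := ‖c‖ₑ) hg2 (.inr (by simp))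
    rw [mul_zero] at this
    refine this.congr fun j => ?_
    rw [← eLpNorm_const_smul]
    congr 1; ext x; simp [StepFun.integral_smul]; ring

lemma sub (hW : IsTwoSidedBrownianMotion P W) (h : IsWienerIntegral P W f J)
    (h' : IsWienerIntegral P W f' J') :
    IsWienerIntegral P W (f - f') (J - J') := by
  convert h.add hW (h'.const_mul (-1)) using 1 <;> (ext x; simp [sub_eq_add_neg])

lemma ae_eq (hW : IsTwoSidedBrownianMotion P W) (h : IsWienerIntegral P W f J)
    (h' : IsWienerIntegral P W f J') : J =ᵐ[P] J' := by
  have h1 := h.sub hW h'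
  have h2 := h1.eLpNorm_eq hW
  rw [sub_self, eLpNorm_zero, eLpNorm_eq_zero_iff h1.2.1.aestronglyMeasurable (by simp)] at h2
  filter_upwards [h2] with ω hω
  exact sub_eq_zero.1 hω

end IsWienerIntegral

lemma exists_isWienerIntegral (hW : IsTwoSidedBrownianMotion P W) (hf : MemLp f 2 volume) :
    ∃ J, IsWienerIntegral P W f J := by
  have hpos : ∀ j : ℕ, ((2 : ℝ≥0∞)⁻¹ ^ j) ≠ 0 := fun j => by simp
  choose g hg using fun j => StepFun.exists_eLpNorm_sub_le hf (hpos j)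
  have h0 : Tendsto (fun j : ℕ => (2 : ℝ≥0∞)⁻¹ ^ j) atTop (𝓝 0) :=
    ENNReal.tendsto_pow_atTop_nhds_zero_of_lt_one (by simp)
  obtain ⟨J, hJ, hlim⟩ := Lp.cauchy_complete_eLpNorm (p := 2) (μ := P) (by norm_num)
    (f := fun j => (g j).integral W) (fun j => hW.memLp_integral (g j))
    (B := fun j => 3 * (2 : ℝ≥0∞)⁻¹ ^ j) (by
      rw [ENNReal.tsum_mul_left, ENNReal.tsum_geometric]
      simp [ENNReal.mul_eq_top]) (by
      intro N n m hn hm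
      rw [← StepFun.integral_sub, hW.eLpNorm_integral, StepFun.eval_sub,
        show (g n).eval - (g m).eval = ((g n).eval - f) - ((g m).eval - f) by abel]
      have hle : ∀ n, N ≤ n → eLpNorm ((g n).eval - f) 2 volume ≤ (2 : ℝ≥0∞)⁻¹ ^ N :=
        fun n hn => (hg n).trans (pow_le_pow_right_of_le_one' (by simp) hn)
      calc _ ≤ _ := eLpNorm_sub_le ((g n).memLp_eval.sub hf).aestronglyMeasurable
            ((g m).memLp_eval.sub hf).aestronglyMeasurable (by norm_num)
        _ ≤ 2⁻¹ ^ N + 2⁻¹ ^ N := add_le_add (hle n hn) (hle m hm)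
        _ = 2 * 2⁻¹ ^ N := by ring
        _ < 3 * 2⁻¹ ^ N := by
          rw [ENNReal.mul_lt_mul_iff_left (hpos N) (by simp)]
          norm_num)
  refine ⟨J, hf, hJ, g, ?_, hlim⟩
  exact tendsto_of_tendsto_of_tendsto_of_le_of_le tendsto_const_nhds h0 (fun _ => zero_le) hg

lemma isWienerIntegral_wienerIntegral (hW : IsTwoSidedBrownianMotion P W)
    (hf : MemLp f 2 volume) : IsWienerIntegral P W f (wienerIntegral P W f) := by
  rw [wienerIntegral, dif_pos (exists_isWienerIntegral hW hf)]
  exact (exists_isWienerIntegral hW hf).choose_spec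

end WienerIntegral

section Gaussian

variable {Ω : Type*} [MeasurableSpace Ω] {P : Measure Ω} {W : ℝ → Ω → ℝ}

lemma IsTwoSidedBrownianMotion.isGaussianProcess_sub (hW : IsTwoSidedBrownianMotion P W) (a : ℝ) :
    IsGaussianProcess (fun t : Ici a => W t - W a) P := by
  refine HasIndepIncrements.isGaussianProcess (fun t => hW.hasGaussianLaw_sub _ _) ?_ ?_
  · refine .of_forall fun ω => ?_
    change W a ω - W a ω = 0
    simp
  · intro n t ht
    have := hW.indep n (fun i => (t i : ℝ)) fun i j hij => ht hij
    simpa using this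

lemma IsTwoSidedBrownianMotion.hasGaussianLaw_sum (hW : IsTwoSidedBrownianMotion P W)
    (s : Finset (NonemptyInterval ℝ)) (c : NonemptyInterval ℝ → ℝ) :
    HasGaussianLaw (fun ω => ∑ I ∈ s, c I * (W I.snd - W I.fst) ω) P := by
  classical
  obtain ⟨a, ha⟩ := (s.image fun I => I.fst).bddBelow
  have ha' : ∀ I : s, a ≤ (I : NonemptyInterval ℝ).fst := fun I =>
    ha (Finset.mem_coe.2 (Finset.mem_image_of_mem _ I.2))
  let p : s → Ici a := fun I => ⟨I.1.fst, ha' I⟩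
  let q : s → Ici a := fun I => ⟨I.1.snd, (ha' I).trans I.1.fst_le_snd⟩
  have key : IsGaussianProcess (fun (I : s) ω => c I * (W I.1.snd - W I.1.fst) ω) P := by
    refine IsGaussianProcess.of_isGaussianProcess (hW.isGaussianProcess_sub a) fun I =>
      ⟨{p I, q I}, c I • (.proj ⟨q I, by simp⟩ - .proj ⟨p I, by simp⟩), fun ω => ?_⟩
    simp [p, q]
  have := key.hasGaussianLaw_fun_sum (I := Finset.univ)
  have e := funext fun ω => Finset.sum_coe_sort s fun I => c I * (W I.snd - W I.fst) ω
  rw [← e]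
  exact this

lemma lintegral_exp_mul_le_of_hasGaussianLaw {X : Ω → ℝ} (hX : HasGaussianLaw X P)
    (h0 : ∫ ω, X ω ∂P = 0) {v : ℝ} (hv : ∫ ω, X ω ^ 2 ∂P ≤ v) (t : ℝ) :
    ∫⁻ ω, ENNReal.ofReal (Real.exp (t * X ω)) ∂P ≤
      ENNReal.ofReal (Real.exp (v * t ^ 2 / 2)) := by
  have := hX.isProbabilityMeasure
  have hm := mgf_gaussianReal hX.map_eq_gaussianReal t
  rw [mgf] at hm
  have hint : Integrable (fun ω => Real.exp (t * X ω)) P :=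
    not_imp_comm.1 integral_undef (by rw [hm]; positivity)
  rw [← ofReal_integral_eq_lintegral_ofReal hint (.of_forall fun ω => (Real.exp_pos _).le), hm, h0]
  refine ENNReal.ofReal_le_ofReal (Real.exp_le_exp.2 ?_)
  have hvar : Var[X; P] ≤ v := (variance_le_expectation_sq hX.aemeasurable.aestronglyMeasurable).trans hv
  rw [Real.coe_toNNReal _ (variance_nonneg _ _)]
  nlinarith [sq_nonneg t]

/-- The norm of `X` has exponential moments of Gaussian type with parameter `σ`. -/
def HasSubgaussianNorm {Ω : Type*} [MeasurableSpace Ω] (P : Measure Ω) (X : Ω → ℂ) (σ : ℝ) : Prop :=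
  ∀ t : ℝ, ∫⁻ ω, ENNReal.ofReal (Real.exp (t * ‖X ω‖)) ∂P ≤
    ENNReal.ofReal (2 * Real.exp (2 * t ^ 2 * σ ^ 2))

lemma HasSubgaussianNorm.mono {X : Ω → ℂ} {σ τ : ℝ} (h : HasSubgaussianNorm P X σ) (hσ : 0 ≤ σ)
    (hτ : σ ≤ τ) : HasSubgaussianNorm P X τ := fun t =>
  (h t).trans (ENNReal.ofReal_le_ofReal (by gcongr))

lemma exp_mul_norm_le (t : ℝ) (z : ℂ) :
    Real.exp (t * ‖z‖) ≤ (Real.exp (2 * t * z.re) + Real.exp (-(2 * t) * z.re) +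
      Real.exp (2 * t * z.im) + Real.exp (-(2 * t) * z.im)) / 2 := by
  have habs : ∀ x : ℝ, Real.exp (2 * (|t| * |x|)) ≤
      Real.exp (2 * t * x) + Real.exp (-(2 * t) * x) := by
    intro x
    rw [← abs_mul]
    rcases abs_cases (t * x) with h | h
    · rw [h.1, ← mul_assoc]
      linarith [Real.exp_pos (-(2 * t) * x)]
    · rw [h.1, show 2 * -(t * x) = -(2 * t) * x by ring]
      linarith [Real.exp_pos (2 * t * x)]
  have h1 : t * ‖z‖ ≤ |t| * |z.re| + |t| * |z.im| := by
    calc t * ‖z‖ ≤ |t| * ‖z‖ := by gcongr; exact le_abs_self t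
      _ ≤ |t| * (|z.re| + |z.im|) := by gcongr; exact Complex.norm_le_abs_re_add_abs_im z
      _ = _ := by ring
  have h2 := Real.exp_le_exp.2 h1
  rw [Real.exp_add] at h2
  have h3 := habs z.re
  have h4 := habs z.im
  rw [mul_comm 2, mul_two, Real.exp_add] at h3 h4
  nlinarith [sq_nonneg (Real.exp (|t| * |z.re|) - Real.exp (|t| * |z.im|))]

lemma hasSubgaussianNorm_of_re_im {X : Ω → ℂ} (hX : AEMeasurable X P) {σ : ℝ}
    (hre : ∀ t : ℝ, ∫⁻ ω, ENNReal.ofReal (Real.exp (t * (X ω).re)) ∂P ≤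
      ENNReal.ofReal (Real.exp (σ ^ 2 * t ^ 2 / 2)))
    (him : ∀ t : ℝ, ∫⁻ ω, ENNReal.ofReal (Real.exp (t * (X ω).im)) ∂P ≤
      ENNReal.ofReal (Real.exp (σ ^ 2 * t ^ 2 / 2))) :
    HasSubgaussianNorm P X σ := by
  intro t
  have hmre : AEMeasurable (fun ω => (X ω).re) P := Complex.measurable_re.comp_aemeasurable hX
  have hmim : AEMeasurable (fun ω => (X ω).im) P := Complex.measurable_im.comp_aemeasurable hX
  set B := Real.exp (2 * t ^ 2 * σ ^ 2) with hB
  have hb : ∀ r : ℝ, r ^ 2 = (2 * t) ^ 2 → ENNReal.ofReal (Real.exp (σ ^ 2 * r ^ 2 / 2)) =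
      ENNReal.ofReal B := by
    intro r hr; rw [hr, hB]; congr 2; ring
  calc ∫⁻ ω, ENNReal.ofReal (Real.exp (t * ‖X ω‖)) ∂P
      ≤ ∫⁻ ω, 2⁻¹ * (ENNReal.ofReal (Real.exp (2 * t * (X ω).re)) +
          ENNReal.ofReal (Real.exp (-(2 * t) * (X ω).re)) +
          ENNReal.ofReal (Real.exp (2 * t * (X ω).im)) +
          ENNReal.ofReal (Real.exp (-(2 * t) * (X ω).im))) ∂P := by
        refine lintegral_mono fun ω => ?_
        refine (ENNReal.ofReal_le_ofReal (exp_mul_norm_le t (X ω))).trans (le_of_eq ?_)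
        rw [div_eq_inv_mul, ENNReal.ofReal_mul (by norm_num),
          ENNReal.ofReal_add (by positivity) (by positivity),
          ENNReal.ofReal_add (by positivity) (by positivity),
          ENNReal.ofReal_add (by positivity) (by positivity),
          ENNReal.ofReal_inv_of_pos two_pos, ENNReal.ofReal_ofNat]
    _ ≤ 2⁻¹ * (ENNReal.ofReal B + ENNReal.ofReal B + ENNReal.ofReal B + ENNReal.ofReal B) := by
        rw [lintegral_const_mul' _ _ (by simp), lintegral_add_left' (by fun_prop),
          lintegral_add_left' (by fun_prop), lintegral_add_left' (by fun_prop)]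
        gcongr
        · exact (hre _).trans_eq (hb _ rfl)
        · exact (hre _).trans_eq (hb _ (by ring))
        · exact (him _).trans_eq (hb _ rfl)
        · exact (him _).trans_eq (hb _ (by ring))
    _ = ENNReal.ofReal (2 * B) := by
        have hB0 : 0 ≤ B := (Real.exp_pos _).le
        rw [← ENNReal.ofReal_add hB0 hB0, ← ENNReal.ofReal_add (by positivity) hB0,
          ← ENNReal.ofReal_add (by positivity) hB0, ← ENNReal.ofReal_ofNat 2,
          ← ENNReal.ofReal_inv_of_pos two_pos, ← ENNReal.ofReal_mul (by norm_num)]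
        congr 1; ring

lemma integral_sq_le_eLpNorm {X : Ω → ℝ} {Y : Ω → ℂ} (hY : MemLp Y 2 P)
    (h : ∀ ω, |X ω| ≤ ‖Y ω‖) : ∫ ω, X ω ^ 2 ∂P ≤ (eLpNorm Y 2 P).toReal ^ 2 := by
  rw [← ENNReal.toReal_pow, eLpNorm_two_sq]
  have hi := hY.integrable_norm_pow (p := 2) two_ne_zero
  rw [← ofReal_integral_eq_lintegral_ofReal hi (.of_forall fun ω => by positivity),
    ENNReal.toReal_ofReal (by positivity)]
  refine integral_mono_of_nonneg (.of_forall fun ω => sq_nonneg _) hi (.of_forall fun ω => ?_)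
  change X ω ^ 2 ≤ ‖Y ω‖ ^ 2
  rw [← sq_abs]
  gcongr
  exact h ω

lemma IsTwoSidedBrownianMotion.hasSubgaussianNorm_integral (hW : IsTwoSidedBrownianMotion P W)
    (g : StepFun) :
    HasSubgaussianNorm P (g.integral W) (eLpNorm g.eval 2 volume).toReal := by
  rw [← hW.eLpNorm_integral]
  have hm := hW.memLp_integral g
  have key : ∀ (c : NonemptyInterval ℝ → ℝ) (X : Ω → ℝ)
      (_ : ∀ ω, X ω = ∑ I ∈ g.support, c I * (W I.snd - W I.fst) ω)
      (_ : ∀ ω, |X ω| ≤ ‖g.integral W ω‖) (t : ℝ),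
      ∫⁻ ω, ENNReal.ofReal (Real.exp (t * X ω)) ∂P ≤
      ENNReal.ofReal (Real.exp ((eLpNorm (g.integral W) 2 P).toReal ^ 2 * t ^ 2 / 2)) := by
    intro c X hX hle t
    refine lintegral_exp_mul_le_of_hasGaussianLaw ?_ ?_ (integral_sq_le_eLpNorm hm hle) t
    · rw [funext hX]; exact hW.hasGaussianLaw_sum _ _
    · simp_rw [hX]
      rw [integral_finsetSum _ fun I _ =>
        ((hW.hasGaussianLaw_sub _ _).integrable).const_mul (c I)]
      refine Finset.sum_eq_zero fun I _ => ?_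
      rw [integral_const_mul, hW.integral_sub, mul_zero]
  refine hasSubgaussianNorm_of_re_im hm.aestronglyMeasurable.aemeasurable
    (key (fun I => (g I).re) _ (fun ω => ?_) fun ω => Complex.abs_re_le_norm _)
    (key (fun I => (g I).im) _ (fun ω => ?_) fun ω => Complex.abs_im_le_norm _)
  · rw [g.integral_eq_sum, Complex.re_sum]
    exact Finset.sum_congr rfl fun I _ => by rw [Complex.re_mul_ofReal]
  · rw [g.integral_eq_sum, Complex.im_sum]
    exact Finset.sum_congr rfl fun I _ => by rw [Complex.im_mul_ofReal]

lemma IsWienerIntegral.hasSubgaussianNorm (hW : IsTwoSidedBrownianMotion P W) {f : ℝ → ℂ}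
    {J : Ω → ℂ} (h : IsWienerIntegral P W f J) :
    HasSubgaussianNorm P J (eLpNorm f 2 volume).toReal := by
  obtain ⟨hf, hJ, g, hg1, hg2⟩ := h
  intro t
  have hσ : Tendsto (fun j => (eLpNorm (g j).eval 2 volume).toReal) atTop
      (𝓝 (eLpNorm f 2 volume).toReal) :=
    (ENNReal.tendsto_toReal hf.2.ne).comp
      (tendsto_eLpNorm_of_tendsto_sub (fun j => (g j).memLp_eval) hf hg1)
  obtain ⟨ns, hns, hae⟩ := (tendstoInMeasure_of_tendsto_eLpNorm two_ne_zero
    (fun j => (hW.memLp_integral (g j)).aestronglyMeasurable) hJ.aestronglyMeasurable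
    hg2).exists_seq_tendsto_ae
  have hb : Tendsto (fun j => ENNReal.ofReal (2 * Real.exp (2 * t ^ 2 *
      (eLpNorm (g (ns j)).eval 2 volume).toReal ^ 2))) atTop (𝓝 (ENNReal.ofReal (2 * Real.exp
        (2 * t ^ 2 * (eLpNorm f 2 volume).toReal ^ 2)))) := by
    refine ((ENNReal.continuous_ofReal.comp (f := fun x : ℝ => 2 * Real.exp (2 * t ^ 2 * x ^ 2))
      (by fun_prop)).tendsto _).comp (hσ.comp hns.tendsto_atTop)
  rw [← hb.liminf_eq]
  calc ∫⁻ ω, ENNReal.ofReal (Real.exp (t * ‖J ω‖)) ∂P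
      ≤ ∫⁻ ω, liminf (fun j => ENNReal.ofReal (Real.exp (t * ‖(g (ns j)).integral W ω‖)))
          atTop ∂P := by
        refine lintegral_mono_ae ?_
        filter_upwards [hae] with ω hω
        exact (((ENNReal.continuous_ofReal.comp (f := fun z : ℂ => Real.exp (t * ‖z‖))
          (by fun_prop)).tendsto _).comp hω).liminf_eq.ge
    _ ≤ liminf (fun j => ∫⁻ ω, ENNReal.ofReal (Real.exp (t * ‖(g (ns j)).integral W ω‖)) ∂P)
          atTop := by
        refine lintegral_liminf_le' fun j => ?_
        have := (hW.memLp_integral (g (ns j))).aestronglyMeasurable.aemeasurable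
        fun_prop
    _ ≤ _ := liminf_le_liminf (.of_forall fun j => hW.hasSubgaussianNorm_integral (g (ns j)) t)

/-- The maximal inequality for finitely many variables with Gaussian exponential moments. -/
lemma lintegral_biSup_enorm_le [IsProbabilityMeasure P] {ι : Type*} (s : Finset ι)
    {X : ι → Ω → ℂ} (hX : ∀ i, AEMeasurable (X i) P) {σ : ℝ} (hσ : 0 < σ)
    (h : ∀ i ∈ s, HasSubgaussianNorm P (X i) σ) {M : ℝ} (hM : 1 ≤ M) (hs : (s.card : ℝ) ≤ M) :
    ∫⁻ ω, ⨆ i ∈ s, ‖X i ω‖ₑ ∂P ≤ ENNReal.ofReal (3 * σ * √(1 + Real.log (2 * M))) := by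
  have hlog : 0 ≤ Real.log (2 * M) := Real.log_nonneg (by linarith)
  set L := 1 + Real.log (2 * M) with hL
  have hL0 : 0 < L := by linarith
  set r := √L / σ with hr
  have hr0 : 0 < r := div_pos (Real.sqrt_pos.2 hL0) hσ
  have hrσ : r ^ 2 * σ ^ 2 = L := by
    rw [hr, div_pow, Real.sq_sqrt hL0.le]; field_simp
  set a := Real.log (2 * M) + 2 * L with ha
  have ha0 : 0 ≤ a := by linarith
  have hexp : Real.exp (-a) * (2 * Real.exp (2 * L)) * M = 1 := by
    rw [ha, neg_add, Real.exp_add, Real.exp_neg, Real.exp_neg, Real.exp_log (by linarith)]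
    field_simp
  have hm : ∀ i, AEMeasurable (fun ω => ENNReal.ofReal (Real.exp (-a)) *
      ENNReal.ofReal (Real.exp (r * ‖X i ω‖))) P := fun i => by
    have := hX i
    fun_prop
  calc ∫⁻ ω, ⨆ i ∈ s, ‖X i ω‖ₑ ∂P
      ≤ ∫⁻ ω, ENNReal.ofReal r⁻¹ * (ENNReal.ofReal a + ∑ i ∈ s, ENNReal.ofReal (Real.exp (-a)) *
          ENNReal.ofReal (Real.exp (r * ‖X i ω‖))) ∂P := by
        refine lintegral_mono fun ω => iSup₂_le fun i hi => ?_
        have h1 : ‖X i ω‖ ≤ r⁻¹ * (a + Real.exp (-a) * Real.exp (r * ‖X i ω‖)) := by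
          rw [← Real.exp_add, inv_mul_eq_div, le_div_iff₀ hr0]
          linarith [Real.add_one_le_exp (-a + r * ‖X i ω‖)]
        rw [← ofReal_norm]
        refine (ENNReal.ofReal_le_ofReal h1).trans ?_
        rw [ENNReal.ofReal_mul (by positivity), ENNReal.ofReal_add ha0 (by positivity),
          ENNReal.ofReal_mul (by positivity)]
        gcongr
        exact Finset.single_le_sum (f := fun i => ENNReal.ofReal (Real.exp (-a)) *
          ENNReal.ofReal (Real.exp (r * ‖X i ω‖))) (fun _ _ => zero_le) hi
    _ = ENNReal.ofReal r⁻¹ * (ENNReal.ofReal a + ∑ i ∈ s, ENNReal.ofReal (Real.exp (-a)) *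
          ∫⁻ ω, ENNReal.ofReal (Real.exp (r * ‖X i ω‖)) ∂P) := by
        rw [lintegral_const_mul' _ _ (by simp), lintegral_add_left' (by fun_prop),
          lintegral_finsetSum' _ fun i _ => hm i, lintegral_const, measure_univ, mul_one]
        simp_rw [lintegral_const_mul' _ _ ENNReal.ofReal_ne_top]
    _ ≤ ENNReal.ofReal r⁻¹ * (ENNReal.ofReal a + ∑ i ∈ s, ENNReal.ofReal (Real.exp (-a)) *
          ENNReal.ofReal (2 * Real.exp (2 * L))) := by
        gcongr with i hi
        refine (h i hi r).trans (le_of_eq ?_)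
        rw [mul_assoc, hrσ]
    _ ≤ ENNReal.ofReal r⁻¹ * (ENNReal.ofReal a + ENNReal.ofReal 1) := by
        have h1 : ENNReal.ofReal (Real.exp (-a)) * ENNReal.ofReal (2 * Real.exp (2 * L)) *
            ENNReal.ofReal M = ENNReal.ofReal 1 := by
          rw [← ENNReal.ofReal_mul (by positivity), ← ENNReal.ofReal_mul (by positivity), hexp]
        rw [Finset.sum_const, nsmul_eq_mul, mul_comm (s.card : ℝ≥0∞), ← h1,
          ← ENNReal.ofReal_natCast]
        gcongr
    _ = ENNReal.ofReal (3 * σ * √L) := by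
        rw [← ENNReal.ofReal_add ha0 zero_le_one, ← ENNReal.ofReal_mul (by positivity)]
        congr 1
        have : a + 1 = 3 * L := by rw [ha, hL]; ring
        rw [this, hr, inv_div]
        have h2 : L = √L * √L := (Real.mul_self_sqrt hL0.le).symm
        have h3 : √L ≠ 0 := (Real.sqrt_pos.2 hL0).ne'
        field_simp
        rw [sq, ← h2]

end Gaussian

section Chaining

/-- The largest increment of `z` between neighbouring points of the grid `2⁻ᵏ ℤ` in `[-N, N]`. -/
noncomputable def dyadicIncr (z : ℝ → ℂ) (N k : ℕ) : ℝ≥0∞ :=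
  ⨆ j ∈ Finset.Icc (-(N * 2 ^ k) : ℤ) (N * 2 ^ k), ‖z ((j + 1) / 2 ^ k) - z (j / 2 ^ k)‖ₑ

/-- The value of `z` at the last point of the grid `2⁻ᵏ ℤ` up to `u`. -/
noncomputable def dyadicApprox (z : ℝ → ℂ) (k : ℕ) (u : ℝ) : ℂ := z (⌊2 ^ k * u⌋ / 2 ^ k)

lemma floor_mem_Icc {N k : ℕ} {u : ℝ} (hu : u ∈ Icc (-N : ℝ) N) :
    ⌊2 ^ k * u⌋ ∈ Finset.Icc (-(N * 2 ^ k) : ℤ) (N * 2 ^ k) := by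
  have h2 : (0 : ℝ) < 2 ^ k := by positivity
  rw [Finset.mem_Icc]
  constructor
  · rw [Int.le_floor]
    push_cast
    nlinarith [hu.1]
  · have : (⌊2 ^ k * u⌋ : ℝ) ≤ N * 2 ^ k := (Int.floor_le _).trans (by nlinarith [hu.2])
    exact_mod_cast this

lemma enorm_sub_le_dyadicIncr (z : ℝ → ℂ) {N k : ℕ} {j : ℤ}
    (hj : j ∈ Finset.Icc (-(N * 2 ^ k) : ℤ) (N * 2 ^ k)) :
    ‖z ((j + 1) / 2 ^ k) - z (j / 2 ^ k)‖ₑ ≤ dyadicIncr z N k :=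
  le_iSup₂ (f := fun (j : ℤ) (_ : j ∈ Finset.Icc (-(N * 2 ^ k) : ℤ) (N * 2 ^ k)) =>
    ‖z ((j + 1) / 2 ^ k) - z (j / 2 ^ k)‖ₑ) j hj

lemma edist_dyadicApprox_succ_le (z : ℝ → ℂ) {N : ℕ} (k : ℕ) {u : ℝ} (hu : u ∈ Icc (-N : ℝ) N) :
    edist (dyadicApprox z k u) (dyadicApprox z (k + 1) u) ≤ dyadicIncr z N (k + 1) := by
  have hmem := floor_mem_Icc (k := k) hu
  have hmem' := floor_mem_Icc (k := k + 1) hu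
  set j := ⌊2 ^ k * u⌋ with hj
  have h1 : (j : ℝ) ≤ 2 ^ k * u := Int.floor_le _
  have h2 : 2 ^ k * u < j + 1 := Int.lt_floor_add_one _
  have e : (j : ℝ) / 2 ^ k = ((2 * j : ℤ) : ℝ) / 2 ^ (k + 1) := by
    push_cast; rw [pow_succ]; field_simp
  rw [edist_comm, edist_eq_enorm_sub, dyadicApprox, dyadicApprox, ← hj, e]
  have hlo : 2 * j ≤ ⌊2 ^ (k + 1) * u⌋ := by
    rw [Int.le_floor]; push_cast; rw [pow_succ]; linarith
  have hhi : ⌊2 ^ (k + 1) * u⌋ < 2 * j + 2 := by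
    rw [Int.floor_lt]; push_cast; rw [pow_succ]; linarith
  rcases (by omega : ⌊2 ^ (k + 1) * u⌋ = 2 * j ∨ ⌊2 ^ (k + 1) * u⌋ = 2 * j + 1) with h | h
  · rw [h]; simp
  · rw [h] at hmem' ⊢
    have := enorm_sub_le_dyadicIncr z (N := N) (k := k + 1) (j := 2 * j) (by
      rw [Finset.mem_Icc] at hmem hmem' ⊢
      have : (2 : ℤ) ^ (k + 1) = 2 * 2 ^ k := by ring
      rw [this] at hmem' ⊢
      constructor <;> nlinarith [hmem.1, hmem'.2])
    exact_mod_cast this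

lemma edist_dyadicApprox_le (z : ℝ → ℂ) {N : ℕ} (k : ℕ) {u v : ℝ} (hu : u ∈ Icc (-N : ℝ) N)
    (hv : v ∈ Icc (-N : ℝ) N) (huv : |u - v| < (2 ^ k)⁻¹) :
    edist (dyadicApprox z k u) (dyadicApprox z k v) ≤ dyadicIncr z N k := by
  wlog h : u ≤ v generalizing u v
  · rw [edist_comm]
    exact this hv hu (by rwa [abs_sub_comm]) (le_of_not_ge h)
  have hmem := floor_mem_Icc (k := k) hu
  have h2 : (0 : ℝ) < 2 ^ k := by positivity
  rw [abs_sub_comm, abs_of_nonneg (by linarith)] at huv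
  have huv' : 2 ^ k * v < 2 ^ k * u + 1 := by
    have := mul_lt_mul_of_pos_left huv h2
    rw [mul_inv_cancel₀ h2.ne'] at this
    linarith
  have huv2 : 2 ^ k * u ≤ 2 ^ k * v := by gcongr
  set j := ⌊2 ^ k * u⌋ with hj
  have hlo : j ≤ ⌊2 ^ k * v⌋ := Int.floor_le_floor huv2
  have hhi : ⌊2 ^ k * v⌋ < j + 2 := by
    rw [Int.floor_lt]; push_cast
    linarith [Int.lt_floor_add_one (2 ^ k * u)]
  rw [edist_comm, edist_eq_enorm_sub, dyadicApprox, dyadicApprox, ← hj]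
  rcases (by omega : ⌊2 ^ k * v⌋ = j ∨ ⌊2 ^ k * v⌋ = j + 1) with h | h
  · rw [h]; simp
  · rw [h]
    have := enorm_sub_le_dyadicIncr z hmem
    exact_mod_cast this

/-- If the maximal dyadic increments of `z` are summable on compact intervals, the dyadic
approximations converge to a continuous function, with an explicit bound. -/
lemma exists_continuous_of_tsum_dyadicIncr (z : ℝ → ℂ)
    (h : ∀ N : ℕ, ∑' k, dyadicIncr z N k ≠ ∞) :
    ∃ ψ : ℝ → ℂ, Continuous ψ ∧
      (∀ u, Tendsto (fun k => dyadicApprox z k u) atTop (𝓝 (ψ u))) ∧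
      ∀ N : ℕ, ⨆ u ∈ Icc (-N : ℝ) N, ‖ψ u‖ₑ ≤
        (⨆ j ∈ Finset.Icc (-N : ℤ) N, ‖z j‖ₑ) + ∑' k, dyadicIncr z N (k + 1) := by
  have hmem : ∀ u : ℝ, ∃ N : ℕ, u ∈ Ioo (-N : ℝ) N := fun u => by
    obtain ⟨N, hN⟩ := exists_nat_gt |u|
    exact ⟨N, abs_lt.1 hN⟩
  have htail : ∀ N : ℕ, Tendsto (fun k => ∑' l, dyadicIncr z N (l + k)) atTop (𝓝 0) :=
    fun N => ENNReal.tendsto_sum_nat_add _ (h N)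
  have hsucc : ∀ N : ℕ, ∑' k, dyadicIncr z N (k + 1) ≠ ∞ := fun N =>
    ne_top_of_le_ne_top (h N) (ENNReal.tsum_comp_le_tsum_of_injective (add_left_injective 1) _)
  have hlim : ∀ u, ∃ y, Tendsto (fun k => dyadicApprox z k u) atTop (𝓝 y) := fun u => by
    obtain ⟨N, hN⟩ := hmem u
    exact cauchySeq_tendsto_of_complete (cauchySeq_of_edist_le_of_tsum_ne_top
      (fun k => dyadicIncr z N (k + 1))
      (fun k => edist_dyadicApprox_succ_le z k (Ioo_subset_Icc_self hN)) (hsucc N))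
  choose ψ hψ using hlim
  have hdist : ∀ (N k : ℕ) (u : ℝ), u ∈ Icc (-N : ℝ) N →
      edist (dyadicApprox z k u) (ψ u) ≤ ∑' l, dyadicIncr z N (l + k + 1) := by
    intro N k u hu
    have := edist_le_tsum_of_edist_le_of_tendsto (fun k => dyadicIncr z N (k + 1))
      (fun k => edist_dyadicApprox_succ_le z k hu) (hψ u) k
    simpa [add_comm k] using this
  refine ⟨ψ, ?_, hψ, fun N => iSup₂_le fun u hu => ?_⟩
  · refine continuous_iff_continuousAt.2 fun u => ?_
    obtain ⟨N, hN⟩ := hmem u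
    refine EMetric.tendsto_nhds.2 ?_
    intro ε hε
    have h3 : Tendsto (fun k => 3 * ∑' l, dyadicIncr z N (l + k)) atTop (𝓝 0) := by
      simpa using ENNReal.Tendsto.const_mul (a := 3) (htail N) (.inr (by simp))
    obtain ⟨k, hk⟩ := (h3.eventually_lt_const hε).exists
    filter_upwards [isOpen_Ioo.mem_nhds hN, Metric.ball_mem_nhds u (ε := (2 ^ k)⁻¹)
      (by positivity)] with v hv hvu
    refine lt_of_le_of_lt ?_ hk
    have hle : ∑' l, dyadicIncr z N (l + k + 1) ≤ ∑' l, dyadicIncr z N (l + k) := by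
      have := ENNReal.tsum_comp_le_tsum_of_injective (add_left_injective 1)
        fun l => dyadicIncr z N (l + k)
      simpa [Function.comp_def, add_right_comm _ 1 k] using this
    have hself : dyadicIncr z N k ≤ ∑' l, dyadicIncr z N (l + k) := by
      simpa using ENNReal.le_tsum (f := fun l => dyadicIncr z N (l + k)) 0
    calc edist (ψ v) (ψ u) ≤ edist (ψ v) (dyadicApprox z k v) +
          edist (dyadicApprox z k v) (dyadicApprox z k u) + edist (dyadicApprox z k u) (ψ u) :=
          edist_triangle4 _ _ _ _
      _ ≤ ∑' l, dyadicIncr z N (l + k) + ∑' l, dyadicIncr z N (l + k) +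
          ∑' l, dyadicIncr z N (l + k) := by
          gcongr
          · rw [edist_comm]
            exact (hdist N k v (Ioo_subset_Icc_self hv)).trans hle
          · exact (edist_dyadicApprox_le z k (Ioo_subset_Icc_self hv) (Ioo_subset_Icc_self hN)
              (by simpa [Real.dist_eq] using hvu)).trans hself
          · exact (hdist N k u (Ioo_subset_Icc_self hN)).trans hle
      _ = 3 * ∑' l, dyadicIncr z N (l + k) := by ring
  · have h0 := hdist N 0 u hu
    simp only [add_zero] at h0
    have h1 : ‖dyadicApprox z 0 u‖ₑ ≤ ⨆ j ∈ Finset.Icc (-N : ℤ) N, ‖z j‖ₑ := by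
      have := floor_mem_Icc (k := 0) hu
      simp only [pow_zero, mul_one, one_mul] at this
      simp only [dyadicApprox, pow_zero, one_mul, div_one]
      exact le_iSup₂ (f := fun (j : ℤ) (_ : j ∈ Finset.Icc (-N : ℤ) N) => ‖z j‖ₑ) _ this
    calc ‖ψ u‖ₑ = ‖dyadicApprox z 0 u - (dyadicApprox z 0 u - ψ u)‖ₑ := by simp
      _ ≤ ‖dyadicApprox z 0 u‖ₑ + ‖dyadicApprox z 0 u - ψ u‖ₑ := enorm_sub_le
      _ ≤ _ := add_le_add h1 (by rwa [← edist_eq_enorm_sub])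

variable {Ω : Type*} [MeasurableSpace Ω] {P : Measure Ω}

lemma aemeasurable_dyadicIncr {Z : ℝ → Ω → ℂ} (hZ : ∀ u, AEMeasurable (Z u) P) (N k : ℕ) :
    AEMeasurable (fun ω => dyadicIncr (fun u => Z u ω) N k) P :=
  AEMeasurable.biSup _ (Finset.countable_toSet _) fun _ _ => ((hZ _).sub (hZ _)).enorm

lemma aemeasurable_biSup_enorm_of_continuous {Ψ : ℝ → Ω → ℂ} (hm : ∀ u, AEMeasurable (Ψ u) P)
    (hc : ∀ ω, Continuous fun u => Ψ u ω) {U : ℝ} (hU : 0 ≤ U) :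
    AEMeasurable (fun ω => ⨆ u ∈ Icc (-U) U, ‖Ψ u ω‖ₑ) P := by
  have hU' : -U ≤ U := by linarith
  have e : (fun ω => ⨆ u ∈ Icc (-U) U, ‖Ψ u ω‖ₑ) =
      fun ω => ⨆ q : ℚ, ‖Ψ (projIcc (-U) U hU' q) ω‖ₑ := by
    ext ω
    refine le_antisymm (iSup₂_le fun u hu => ?_) (iSup_le fun q => ?_)
    · have hcl : IsClosed {x : ℝ | ‖Ψ (projIcc (-U) U hU' x) ω‖ₑ ≤
          ⨆ q : ℚ, ‖Ψ (projIcc (-U) U hU' q) ω‖ₑ} :=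
        isClosed_le (continuous_enorm.comp ((hc ω).comp
          (continuous_subtype_val.comp continuous_projIcc))) continuous_const
      have : ‖Ψ (projIcc (-U) U hU' u) ω‖ₑ ≤ ⨆ q : ℚ, ‖Ψ (projIcc (-U) U hU' q) ω‖ₑ :=
        (Rat.denseRange_cast (𝕜 := ℝ)).induction_on u hcl fun q =>
           le_iSup (fun q : ℚ => ‖Ψ (projIcc (-U) U hU' q) ω‖ₑ) q
      simpa [projIcc_of_mem hU' hu] using this
    · exact le_iSup₂ (f := fun (u : ℝ) (_ : u ∈ Icc (-U) U) => ‖Ψ u ω‖ₑ) _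
        (projIcc (-U) U hU' q).2
  rw [e]
  exact AEMeasurable.iSup fun q => (hm _).enorm

lemma sqrt_one_add_log_le {N : ℕ} (hN : 1 ≤ N) (k : ℕ) :
    √(1 + Real.log (2 * (3 * N * 2 ^ k))) ≤ √(3 + Real.log N) * (k + 1) := by
  have hN' : (1 : ℝ) ≤ N := by exact_mod_cast hN
  have hlogN : 0 ≤ Real.log N := Real.log_nonneg hN'
  have h6 : Real.log 6 ≤ 2 := by
    rw [Real.log_le_iff_le_exp (by norm_num), show (2 : ℝ) = 1 + 1 by norm_num, Real.exp_add]
    nlinarith [Real.exp_one_gt_d9]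
  have e : Real.log (2 * (3 * N * 2 ^ k)) = Real.log 6 + Real.log N + k * Real.log 2 := by
    rw [show 2 * (3 * (N : ℝ) * 2 ^ k) = 6 * N * 2 ^ k by ring, Real.log_mul (by positivity)
      (by positivity), Real.log_mul (by norm_num) (by positivity), Real.log_pow]
  have hk : (0 : ℝ) ≤ k := by positivity
  rw [Real.sqrt_le_left (by positivity), mul_pow, Real.sq_sqrt (by linarith), e]
  nlinarith [Real.log_two_lt_d9, mul_nonneg hlogN hk, mul_nonneg hlogN (mul_nonneg hk hk)]

/-- Constant in the chaining bound for increments of size `K |u - v| ^ γ`. -/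
noncomputable def chainingConst (K γ : ℝ) : ℝ :=
  3 * K * (1 + ∑' k : ℕ, ((k : ℝ) + 1) * ((2 : ℝ) ^ (-γ)) ^ k)

variable [IsProbabilityMeasure P] {Z : ℝ → Ω → ℂ} {K γ : ℝ}

lemma lintegral_dyadicIncr_le (hZ : ∀ u, AEMeasurable (Z u) P) (hK : 0 < K)
    (hincr : ∀ u v, HasSubgaussianNorm P (fun ω => Z u ω - Z v ω) (K * |u - v| ^ γ))
    {N : ℕ} (hN : 1 ≤ N) (k : ℕ) :
    ∫⁻ ω, dyadicIncr (fun u => Z u ω) N k ∂P ≤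
      ENNReal.ofReal (3 * K * √(3 + Real.log N) * ((k + 1) * ((2 : ℝ) ^ (-γ)) ^ k)) := by
  have hN' : (1 : ℝ) ≤ N := by exact_mod_cast hN
  have h2k : (1 : ℝ) ≤ 2 ^ k := one_le_pow₀ (by norm_num)
  have hN2 : (1 : ℝ) ≤ N * 2 ^ k := one_le_mul_of_one_le_of_one_le hN' h2k
  have hr : (0 : ℝ) < ((2 : ℝ) ^ (-γ)) ^ k := by positivity
  refine (lintegral_biSup_enorm_le (Finset.Icc (-(N * 2 ^ k) : ℤ) (N * 2 ^ k))
    (X := fun j ω => Z ((j + 1) / 2 ^ k) ω - Z (j / 2 ^ k) ω)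
    (fun j => (hZ _).sub (hZ _)) (mul_pos hK hr) (fun j _ => ?_)
    (M := 3 * N * 2 ^ k) (by linarith) ?_).trans (ENNReal.ofReal_le_ofReal ?_)
  · have := hincr ((j + 1) / 2 ^ k) (j / 2 ^ k)
    have e : |((j : ℝ) + 1) / 2 ^ k - j / 2 ^ k| ^ γ = ((2 : ℝ) ^ (-γ)) ^ k := by
      rw [← sub_div, add_sub_cancel_left, abs_of_pos (by positivity), one_div,
        ← Real.rpow_natCast, ← Real.rpow_natCast, ← Real.rpow_neg (by norm_num),
        ← Real.rpow_mul (by norm_num), ← Real.rpow_mul (by norm_num)]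
      congr 1; ring
    rwa [e] at this
  · rw [Int.card_Icc]
    have : ((((N : ℤ) * 2 ^ k + 1 - -(N * 2 ^ k)).toNat : ℤ) : ℝ) ≤ 3 * N * 2 ^ k := by
      rw [Int.toNat_of_nonneg (by rw [sub_neg_eq_add]; positivity)]
      push_cast
      linarith
    exact_mod_cast this
  · have := sqrt_one_add_log_le hN k
    calc _ ≤ 3 * (K * ((2 : ℝ) ^ (-γ)) ^ k) * (√(3 + Real.log N) * (k + 1)) := by gcongr
      _ = _ := by ring

lemma lintegral_biSup_int_le (hZ : ∀ u, AEMeasurable (Z u) P) (hK : 0 < K)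
    (h0 : ∀ u, HasSubgaussianNorm P (Z u) K) {N : ℕ} (hN : 1 ≤ N) :
    ∫⁻ ω, ⨆ j ∈ Finset.Icc (-N : ℤ) N, ‖Z j ω‖ₑ ∂P ≤
      ENNReal.ofReal (3 * K * √(3 + Real.log N)) := by
  have hN' : (1 : ℝ) ≤ N := by exact_mod_cast hN
  refine (lintegral_biSup_enorm_le (Finset.Icc (-N : ℤ) N) (X := fun j => Z j)
    (fun j => hZ _) hK (fun j _ => h0 _) (M := 3 * N * 2 ^ 0) (by linarith) ?_).trans
    (ENNReal.ofReal_le_ofReal ?_)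
  · rw [Int.card_Icc]
    have : ((((N : ℤ) + 1 - -N).toNat : ℤ) : ℝ) ≤ 3 * N * 2 ^ 0 := by
      rw [Int.toNat_of_nonneg (by rw [sub_neg_eq_add]; positivity)]
      push_cast
      linarith
    exact_mod_cast this
  · have := sqrt_one_add_log_le hN 0
    simp only [Nat.cast_zero, zero_add, mul_one] at this
    gcongr

lemma summable_succ_mul_rpow_neg_pow (hγ : 0 < γ) :
    Summable fun k : ℕ => ((k : ℝ) + 1) * ((2 : ℝ) ^ (-γ)) ^ k := by
  have hr : ‖(2 : ℝ) ^ (-γ)‖ < 1 := by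
    rw [Real.norm_of_nonneg (by positivity)]
    exact Real.rpow_lt_one_of_one_lt_of_neg (by norm_num) (by linarith)
  have h1 := summable_pow_mul_geometric_of_norm_lt_one 1 hr
  have h2 := summable_geometric_of_norm_lt_one hr
  refine (h1.add h2).congr fun k => ?_
  ring

lemma tsum_lintegral_dyadicIncr_le (hZ : ∀ u, AEMeasurable (Z u) P) (hK : 0 < K) (hγ : 0 < γ)
    (hincr : ∀ u v, HasSubgaussianNorm P (fun ω => Z u ω - Z v ω) (K * |u - v| ^ γ))
    {N : ℕ} (hN : 1 ≤ N) :
    ∫⁻ ω, ∑' k, dyadicIncr (fun u => Z u ω) N k ∂P ≤ ENNReal.ofReal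
      (3 * K * √(3 + Real.log N) * ∑' k : ℕ, ((k : ℝ) + 1) * ((2 : ℝ) ^ (-γ)) ^ k) := by
  rw [lintegral_tsum fun k => aemeasurable_dyadicIncr hZ N k, ← tsum_mul_left,
    ENNReal.ofReal_tsum_of_nonneg (fun k => by positivity)
      ((summable_succ_mul_rpow_neg_pow hγ).mul_left _)]
  exact ENNReal.tsum_le_tsum fun k => lintegral_dyadicIncr_le hZ hK hincr hN k

/-- A process whose increments have Gaussian tails at Hölder scale has a version with continuous
paths, whose expected supremum over `[-N, N]` grows at most like `√(log N)`. -/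
theorem exists_continuous_version (hZ : ∀ u, AEMeasurable (Z u) P) (hK : 0 < K) (hγ : 0 < γ)
    (hincr : ∀ u v, HasSubgaussianNorm P (fun ω => Z u ω - Z v ω) (K * |u - v| ^ γ))
    (h0 : ∀ u, HasSubgaussianNorm P (Z u) K) :
    ∃ Ψ : ℝ → Ω → ℂ, (∀ u, Ψ u =ᵐ[P] Z u) ∧ (∀ ω, Continuous fun u => Ψ u ω) ∧
      ∀ N : ℕ, 1 ≤ N → ∫⁻ ω, ⨆ u ∈ Icc (-N : ℝ) N, ‖Ψ u ω‖ₑ ∂P ≤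
        ENNReal.ofReal (chainingConst K γ * √(3 + Real.log N)) := by
  classical
  have hgood : ∀ᵐ ω ∂P, ∀ N : ℕ, ∑' k, dyadicIncr (fun u => Z u ω) N k ≠ ∞ := by
    have hpos : ∀ N : ℕ, 1 ≤ N → ∀ᵐ ω ∂P, ∑' k, dyadicIncr (fun u => Z u ω) N k ≠ ∞ := by
      intro N hN
      have hm : AEMeasurable (fun ω => ∑' k, dyadicIncr (fun u => Z u ω) N k) P :=
        AEMeasurable.tsum fun k => aemeasurable_dyadicIncr hZ N k
      filter_upwards [ae_lt_top' hm (ne_top_of_le_ne_top ENNReal.ofReal_ne_top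
        (tsum_lintegral_dyadicIncr_le hZ hK hγ hincr hN))] with ω hω using hω.ne
    rw [ae_all_iff]
    intro N
    filter_upwards [hpos (N + 1) (by omega)] with ω hω
    refine ne_top_of_le_ne_top hω (ENNReal.tsum_le_tsum fun k => ?_)
    refine biSup_mono fun j hj => ?_
    rw [Finset.mem_Icc] at hj ⊢
    have : (0 : ℤ) ≤ 2 ^ k := by positivity
    push_cast
    constructor <;> nlinarith [hj.1, hj.2]
  choose! ψ hcont hlim hsup using fun ω => exists_continuous_of_tsum_dyadicIncr fun u => Z u ω
  refine ⟨fun u ω => if ∀ N : ℕ, ∑' k, dyadicIncr (fun u => Z u ω) N k ≠ ∞ then ψ ω u else 0,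
    fun u => ?_, fun ω => ?_, fun N hN => ?_⟩
  · have hae : ∀ᵐ ω ∂P, Tendsto (fun k => dyadicApprox (fun u => Z u ω) k u) atTop
        (𝓝 (if ∀ N : ℕ, ∑' k, dyadicIncr (fun u => Z u ω) N k ≠ ∞ then ψ ω u else 0)) := by
      filter_upwards [hgood] with ω hω
      rw [if_pos hω]
      exact hlim ω hω u
    have hmeas : ∀ k : ℕ, AEMeasurable (fun ω => dyadicApprox (fun u => Z u ω) k u) P :=
      fun k => hZ _
    refine tendstoInMeasure_ae_unique (tendstoInMeasure_of_tendsto_ae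
      (fun k => (hmeas k).aestronglyMeasurable) hae)
      (tendstoInMeasure_of_tendsto_eLpNorm one_ne_zero
        (fun k => (hmeas k).aestronglyMeasurable) (hZ u).aestronglyMeasurable ?_)
    have hbound : ∀ k : ℕ, eLpNorm ((fun ω => dyadicApprox (fun u => Z u ω) k u) - Z u) 1 P ≤
        ENNReal.ofReal (3 * (K * ((2 : ℝ) ^ (-γ)) ^ k) * √(1 + Real.log (2 * 1))) := by
      intro k
      have h2 : (0 : ℝ) < 2 ^ k := by positivity
      have hd : |⌊2 ^ k * u⌋ / 2 ^ k - u| ≤ ((2 : ℝ) ^ k)⁻¹ := by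
        rw [abs_sub_comm, abs_le]
        have h1 : (⌊2 ^ k * u⌋ : ℝ) ≤ 2 ^ k * u := Int.floor_le _
        have h3 := Int.lt_floor_add_one (2 ^ k * u)
        have e : u - ⌊2 ^ k * u⌋ / 2 ^ k = (2 ^ k * u - ⌊2 ^ k * u⌋) * (2 ^ k)⁻¹ := by
          field_simp
        rw [e]
        have h4 : (0 : ℝ) < (2 ^ k)⁻¹ := by positivity
        constructor <;> nlinarith
      have hs : HasSubgaussianNorm P (fun ω => Z (⌊2 ^ k * u⌋ / 2 ^ k) ω - Z u ω)
          (K * ((2 : ℝ) ^ (-γ)) ^ k) := by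
        refine (hincr _ _).mono (by positivity) ?_
        gcongr
        refine (Real.rpow_le_rpow (abs_nonneg _) hd hγ.le).trans (le_of_eq ?_)
        rw [← Real.rpow_natCast, ← Real.rpow_natCast, ← Real.rpow_neg (by norm_num),
          ← Real.rpow_mul (by norm_num), ← Real.rpow_mul (by norm_num)]
        congr 1; ring
      have := lintegral_biSup_enorm_le (P := P) (Finset.univ : Finset Unit)
        (X := fun _ ω => Z (⌊2 ^ k * u⌋ / 2 ^ k) ω - Z u ω) (fun _ => (hZ _).sub (hZ _))
        (σ := K * ((2 : ℝ) ^ (-γ)) ^ k) (by positivity) (fun _ _ => hs) le_rfl (by simp)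
      rw [eLpNorm_one_eq_lintegral_enorm]
      simpa [dyadicApprox] using this
    refine tendsto_of_tendsto_of_tendsto_of_le_of_le tendsto_const_nhds ?_
      (fun _ => zero_le) hbound
    have hr : Tendsto (fun k : ℕ => ((2 : ℝ) ^ (-γ)) ^ k) atTop (𝓝 0) :=
      tendsto_pow_atTop_nhds_zero_of_lt_one (by positivity)
        (Real.rpow_lt_one_of_one_lt_of_neg (by norm_num) (by linarith))
    have := ((hr.const_mul K).const_mul 3).mul_const (√(1 + Real.log (2 * 1)))
    simpa [Function.comp_def] using (ENNReal.continuous_ofReal.tendsto _).comp this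
  · by_cases hω : ∀ N : ℕ, ∑' k, dyadicIncr (fun u => Z u ω) N k ≠ ∞
    · simpa only [if_pos hω] using hcont ω hω
    · simpa only [if_neg hω] using continuous_const
  · calc _ ≤ ∫⁻ ω, ((⨆ j ∈ Finset.Icc (-N : ℤ) N, ‖Z j ω‖ₑ) +
          ∑' k, dyadicIncr (fun u => Z u ω) N k) ∂P := by
          refine lintegral_mono_ae ?_
          filter_upwards [hgood] with ω hω
          simp only [if_pos hω]
          refine (hsup ω hω N).trans ?_
          refine add_le_add le_rfl ?_
          exact ENNReal.tsum_comp_le_tsum_of_injective (add_left_injective 1) _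
      _ ≤ ENNReal.ofReal (3 * K * √(3 + Real.log N)) + ENNReal.ofReal (3 * K *
          √(3 + Real.log N) * ∑' k : ℕ, ((k : ℝ) + 1) * ((2 : ℝ) ^ (-γ)) ^ k) := by
          rw [lintegral_add_right' _ (AEMeasurable.tsum fun k =>
            aemeasurable_dyadicIncr hZ N k)]
          exact add_le_add (lintegral_biSup_int_le hZ hK h0 hN)
            (tsum_lintegral_dyadicIncr_le hZ hK hγ hincr hN)
      _ = _ := by
          rw [← ENNReal.ofReal_add (by positivity)
            (mul_nonneg (by positivity) (tsum_nonneg fun k => by positivity)), chainingConst]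
          congr 1; ring

end Chaining

section L2Bounds

variable {w : ℝ → ℝ}

lemma eLpNorm_two_sq_le_of_norm_sq_le (hw : Integrable w) {f : ℝ → ℂ} {C : ℝ}
    (h : ∀ x, ‖f x‖ ^ 2 ≤ C * w x) :
    eLpNorm f 2 volume ^ 2 ≤ ENNReal.ofReal (C * ∫ x, w x) := by
  rw [eLpNorm_two_sq, ← integral_const_mul, ofReal_integral_eq_lintegral_ofReal (hw.const_mul C)
    (.of_forall fun x => (sq_nonneg _).trans (h x))]
  exact lintegral_mono fun x => ENNReal.ofReal_le_ofReal (h x)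

lemma memLp_two_of_norm_sq_le (hw : Integrable w) {f : ℝ → ℂ}
    (hf : AEStronglyMeasurable f volume) {C : ℝ} (h : ∀ x, ‖f x‖ ^ 2 ≤ C * w x) :
    MemLp f 2 volume := by
  refine ⟨hf, ?_⟩
  have := (eLpNorm_two_sq_le_of_norm_sq_le hw h).trans_lt ENNReal.ofReal_lt_top
  exact (ENNReal.pow_lt_top_iff.1 this).resolve_right two_ne_zero

lemma toReal_eLpNorm_two_le_of_norm_sq_le (hw : Integrable w) (hw0 : 0 ≤ w) {f : ℝ → ℂ} {C : ℝ}
    (hC : 0 ≤ C) (h : ∀ x, ‖f x‖ ^ 2 ≤ C ^ 2 * w x) :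
    (eLpNorm f 2 volume).toReal ≤ C * √(∫ x, w x) := by
  have hA : 0 ≤ ∫ x, w x := integral_nonneg hw0
  have := ENNReal.toReal_mono ENNReal.ofReal_ne_top (eLpNorm_two_sq_le_of_norm_sq_le hw h)
  rw [ENNReal.toReal_pow, ENNReal.toReal_ofReal (by positivity)] at this
  refine (Real.le_sqrt_of_sq_le this).trans (le_of_eq ?_)
  rw [Real.sqrt_mul (sq_nonneg C), Real.sqrt_sq hC]

/-- Differentiation in `L²(ℝ)` by dominated convergence. -/
lemma tendsto_eLpNorm_slope_sub (hw : Integrable w) {F F' : ℝ → ℝ → ℂ}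
    (hF : ∀ u, AEStronglyMeasurable (F u) volume) (hF' : ∀ u, AEStronglyMeasurable (F' u) volume)
    (hd : ∀ u x, HasDerivAt (fun v => F v x) (F' u x) u) {u C : ℝ}
    (hb : ∀ v ∈ Icc (u - 1) (u + 1), ∀ x, ‖F' v x‖ ^ 2 ≤ C * w x) :
    Tendsto (fun h : ℝ => eLpNorm (fun x => (F (u + h) x - F u x) / (h : ℂ) - F' u x) 2 volume)
      (𝓝[≠] 0) (𝓝 0) := by
  have hsq : Tendsto (fun h : ℝ => eLpNorm (fun x => (F (u + h) x - F u x) / (h : ℂ) - F' u x) 2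
      volume ^ 2) (𝓝[≠] 0) (𝓝 0) := by
    simp_rw [eLpNorm_two_sq]
    rw [← lintegral_zero (μ := (volume : Measure ℝ))]
    refine tendsto_lintegral_filter_of_dominated_convergence'
      (fun x => ENNReal.ofReal (4 * (C * w x))) ?_ ?_ ?_ ?_
    · refine .of_forall fun h => ?_
      have h1 := (hF (u + h)).aemeasurable
      have h2 := (hF u).aemeasurable
      have h3 := (hF' u).aemeasurable
      fun_prop
    · have hmem : ∀ᶠ h : ℝ in 𝓝[≠] 0, h ∈ Icc (-1 : ℝ) 1 ∧ h ≠ 0 := by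
        refine Filter.Eventually.and ?_ self_mem_nhdsWithin
        exact mem_nhdsWithin_of_mem_nhds (Icc_mem_nhds (by norm_num) (by norm_num))
      filter_upwards [hmem] with h ⟨hh, h0⟩
      refine .of_forall fun x => ENNReal.ofReal_le_ofReal ?_
      have hbx : ∀ v ∈ Icc (u - 1) (u + 1), ‖F' v x‖ ≤ √(C * w x) := fun v hv =>
        Real.le_sqrt_of_sq_le (hb v hv x)
      have hmv := (convex_Icc (u - 1) (u + 1)).norm_image_sub_le_of_norm_hasDerivWithin_le
        (f := fun v => F v x) (fun v _ => (hd v x).hasDerivWithinAt) hbx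
        (show u ∈ Icc (u - 1) (u + 1) by constructor <;> linarith)
        (show u + h ∈ Icc (u - 1) (u + 1) by constructor <;> linarith [hh.1, hh.2])
      have h1 : ‖(F (u + h) x - F u x) / (h : ℂ)‖ ≤ √(C * w x) := by
        rw [norm_div, Complex.norm_real, div_le_iff₀ (norm_pos_iff.2 h0)]
        simpa using hmv
      have h2 := norm_sub_le_of_le h1 (hbx u (by constructor <;> linarith))
      have h3 : 0 ≤ C * w x := (sq_nonneg _).trans (hb u (by constructor <;> linarith) x)
      calc _ ≤ (√(C * w x) + √(C * w x)) ^ 2 := by gcongr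
        _ = 4 * (√(C * w x)) ^ 2 := by ring
        _ = _ := by rw [Real.sq_sqrt h3]
    · exact ((hw.const_mul C).const_mul 4).lintegral_lt_top.ne
    · refine .of_forall fun x => ?_
      have h1 := (hd u x).tendsto_slope_zero
      have h2 : Tendsto (fun h : ℝ => (F (u + h) x - F u x) / (h : ℂ) - F' u x) (𝓝[≠] 0) (𝓝 0) := by
        rw [← sub_self (F' u x)]
        refine (h1.congr fun h => ?_).sub tendsto_const_nhds
        rw [div_eq_inv_mul, ← Complex.ofReal_inv, Complex.real_smul]
      have h3 := (ENNReal.continuous_ofReal.tendsto _).comp (h2.norm.pow 2)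
      simpa [Function.comp_def] using h3
  have := (ENNReal.continuous_rpow_const (y := (2 : ℝ)⁻¹)).tendsto 0 |>.comp hsq
  rw [ENNReal.zero_rpow_of_pos (by norm_num)] at this
  refine this.congr fun h => ?_
  simp only [Function.comp_apply]
  rw [← ENNReal.rpow_natCast, ← ENNReal.rpow_mul]
  norm_num

end L2Bounds

section Moments

/-- The integrand `e^{iux-x} x^j ρ(x)`. -/
noncomputable def momentIntegrand (ρ : ℝ → ℝ) (j : Fin 3) (u x : ℝ) : ℂ :=
  Complex.exp (Complex.I * u * x - x) * (x : ℂ) ^ (j : ℕ) * (ρ x : ℂ)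

/-- The coefficients expressing the processes through the integrals of `momentIntegrand`. -/
noncomputable def noiseCoeff (u : ℝ) : Fin 3 → Fin 3 → ℂ :=
  ![![u * (u - Complex.I), 0, 0],
    ![2 * u - Complex.I, Complex.I * u ^ 2 + u, 0],
    ![2, 2 * (2 * Complex.I * u + 1), u * (Complex.I - u)]]

/-- The integrand of `errorProcess`, including the factor in front of the integral. -/
noncomputable def errorIntegrand (ρ : ℝ → ℝ) (k : Fin 3) (u x : ℝ) : ℂ :=
  ∑ j, noiseCoeff u k j * momentIntegrand ρ j u x

/-- The weight `(1 + |x|)^m e^{-2x} ρ²(x)`. -/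
noncomputable def noiseWeight (m : ℝ) (ρ : ℝ → ℝ) (x : ℝ) : ℝ :=
  (1 + |x|) ^ m * Real.exp (-2 * x) * ρ x ^ 2

variable {ρ : ℝ → ℝ} {m : ℝ}

lemma errorIntegrand_eq (ρ : ℝ → ℝ) (k : Fin 3) (u x : ℝ) :
    errorIntegrand ρ k u x =
      (if k = 0 then u * (u - Complex.I) else 1) * noiseIntegrand ρ k u x := by
  fin_cases k <;>
  simp [errorIntegrand, noiseCoeff, momentIntegrand, noiseIntegrand, Fin.sum_univ_three] <;> ring

lemma hasDerivAt_momentIntegrand (ρ : ℝ → ℝ) (j : Fin 3) (u x : ℝ) :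
    HasDerivAt (fun v => momentIntegrand ρ j v x)
      (Complex.I * x * momentIntegrand ρ j u x) u := by
  unfold momentIntegrand
  have h1 : HasDerivAt (fun v : ℝ => Complex.I * v * x - x) (Complex.I * x) u := by
    simpa using (((Complex.ofRealCLM.hasDerivAt (x := u)).const_mul Complex.I).mul_const
      (x : ℂ)).sub_const (x : ℂ)
  convert! ((h1.cexp.mul_const ((x : ℂ) ^ (j : ℕ))).mul_const (ρ x : ℂ)) using 1
  ring

lemma hasDerivAt_errorIntegrand_zero (u x : ℝ) (ρ : ℝ → ℝ) :
    HasDerivAt (fun v => errorIntegrand ρ 0 v x) (errorIntegrand ρ 1 u x) u := by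
  have hid : HasDerivAt (fun v : ℝ => (v : ℂ)) 1 u := Complex.ofRealCLM.hasDerivAt
  have h := (hid.mul (hid.sub_const Complex.I)).mul (hasDerivAt_momentIntegrand ρ 0 u x)
  simp only [errorIntegrand, noiseCoeff, Fin.sum_univ_three]
  simp
  convert! h using 1
  simp [momentIntegrand]
  linear_combination ((u : ℂ) * x * Complex.exp (Complex.I * u * x - x) * ρ x) * Complex.I_sq

lemma hasDerivAt_errorIntegrand_one (u x : ℝ) (ρ : ℝ → ℝ) :
    HasDerivAt (fun v => errorIntegrand ρ 1 v x) (errorIntegrand ρ 2 u x) u := by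
  have hid : HasDerivAt (fun v : ℝ => (v : ℂ)) 1 u := Complex.ofRealCLM.hasDerivAt
  have h := (((hid.const_mul 2).sub_const Complex.I).mul
    (hasDerivAt_momentIntegrand ρ 0 u x)).add
    ((((hid.pow 2).const_mul Complex.I).add hid).mul (hasDerivAt_momentIntegrand ρ 1 u x))
  simp only [errorIntegrand, noiseCoeff, Fin.sum_univ_three]
  simp
  convert! h using 1
  simp [momentIntegrand]
  linear_combination (Complex.exp (Complex.I * u * x - x) * ρ x * (x - u ^ 2 * x ^ 2)) *
    Complex.I_sq

lemma norm_momentIntegrand (ρ : ℝ → ℝ) (j : Fin 3) (u x : ℝ) :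
    ‖momentIntegrand ρ j u x‖ = Real.exp (-x) * |x| ^ (j : ℕ) * |ρ x| := by
  simp [momentIntegrand, Complex.norm_exp]

lemma aestronglyMeasurable_momentIntegrand (hρ : AEMeasurable ρ volume) (j : Fin 3) (u : ℝ) :
    AEStronglyMeasurable (momentIntegrand ρ j u) volume := by
  unfold momentIntegrand
  refine AEMeasurable.aestronglyMeasurable ?_
  fun_prop

lemma noiseWeight_nonneg (m : ℝ) (ρ : ℝ → ℝ) : 0 ≤ noiseWeight m ρ := fun x => by
  unfold noiseWeight
  positivity

lemma rpow_mul_norm_momentIntegrand_sq_le {γ : ℝ} (hγ : 0 ≤ γ) (hγm : 2 * γ + 4 ≤ m)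
    (j : Fin 3) (u x : ℝ) :
    (|x| ^ γ * ‖momentIntegrand ρ j u x‖) ^ 2 ≤ noiseWeight m ρ x := by
  have h1 : 1 ≤ 1 + |x| := by linarith [abs_nonneg x]
  have h2 : |x| ^ γ * |x| ^ (j : ℕ) ≤ (1 + |x|) ^ (γ + 2) := by
    rw [Real.rpow_add (by positivity), Real.rpow_ofNat]
    have hj : (j : ℕ) ≤ 2 := by omega
    have h3 : |x| ^ (j : ℕ) ≤ (1 + |x|) ^ 2 :=
      (pow_le_pow_left₀ (abs_nonneg x) (by linarith) _).trans (pow_le_pow_right₀ h1 hj)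
    gcongr
    linarith
  rw [norm_momentIntegrand, noiseWeight]
  calc (|x| ^ γ * (Real.exp (-x) * |x| ^ (j : ℕ) * |ρ x|)) ^ 2
      = (|x| ^ γ * |x| ^ (j : ℕ)) ^ 2 * Real.exp (-x) ^ 2 * |ρ x| ^ 2 := by ring
    _ ≤ ((1 + |x|) ^ (γ + 2)) ^ 2 * Real.exp (-x) ^ 2 * |ρ x| ^ 2 := by gcongr
    _ = (1 + |x|) ^ (2 * γ + 4) * Real.exp (-2 * x) * ρ x ^ 2 := by
      rw [← Real.rpow_natCast, ← Real.rpow_mul (by positivity), sq_abs, sq (Real.exp _),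
        ← Real.exp_add]
      push_cast
      ring_nf
    _ ≤ _ := by gcongr

lemma norm_sq_momentIntegrand_le (hm : 4 ≤ m) (j : Fin 3) (u x : ℝ) :
    ‖momentIntegrand ρ j u x‖ ^ 2 ≤ 1 ^ 2 * noiseWeight m ρ x := by
  have := rpow_mul_norm_momentIntegrand_sq_le (ρ := ρ) le_rfl (by linarith : 2 * 0 + 4 ≤ m) j u x
  simpa using this

lemma norm_exp_I_mul_sub_one_le {γ : ℝ} (hγ : 0 < γ) (hγ1 : γ ≤ 1) (t : ℝ) :
    ‖Complex.exp (Complex.I * t) - 1‖ ≤ 2 * |t| ^ γ := by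
  rcases le_total |t| 1 with h | h
  · have h1 := Real.norm_exp_I_mul_ofReal_sub_one_le (x := t)
    have h2 : |t| ≤ |t| ^ γ := by
      simpa using Real.rpow_le_rpow_of_exponent_ge' (abs_nonneg t) h hγ.le hγ1
    rw [Real.norm_eq_abs] at h1
    linarith [abs_nonneg t]
  · have h1 : ‖Complex.exp (Complex.I * t)‖ = 1 := by
      rw [mul_comm, Complex.norm_exp_ofReal_mul_I]
    have h2 : 1 ≤ |t| ^ γ := Real.one_le_rpow h hγ.le
    have := norm_sub_le (Complex.exp (Complex.I * t)) 1
    rw [h1, norm_one] at this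
    linarith

lemma norm_sq_momentIntegrand_sub_le {γ : ℝ} (hγ : 0 < γ) (hγ1 : γ ≤ 1) (hγm : 2 * γ + 4 ≤ m)
    (j : Fin 3) (u v x : ℝ) :
    ‖momentIntegrand ρ j u x - momentIntegrand ρ j v x‖ ^ 2 ≤
      (2 * |u - v| ^ γ) ^ 2 * noiseWeight m ρ x := by
  have e : momentIntegrand ρ j u x - momentIntegrand ρ j v x =
      (Complex.exp (Complex.I * ((u - v) * x : ℝ)) - 1) * momentIntegrand ρ j v x := by
    have : Complex.exp (Complex.I * u * x - x) =
        Complex.exp (Complex.I * ((u - v) * x : ℝ)) * Complex.exp (Complex.I * v * x - x) := by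
      rw [← Complex.exp_add]; congr 1; push_cast; ring
    rw [momentIntegrand, momentIntegrand, this]
    ring
  have h := norm_exp_I_mul_sub_one_le hγ hγ1 ((u - v) * x)
  rw [abs_mul, Real.mul_rpow (abs_nonneg _) (abs_nonneg _)] at h
  rw [e, norm_mul]
  calc _ ≤ (2 * (|u - v| ^ γ * |x| ^ γ) * ‖momentIntegrand ρ j v x‖) ^ 2 := by gcongr
    _ = (2 * |u - v| ^ γ) ^ 2 * (|x| ^ γ * ‖momentIntegrand ρ j v x‖) ^ 2 := by ring
    _ ≤ _ := by
      gcongr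
      exact rpow_mul_norm_momentIntegrand_sq_le hγ.le hγm j v x

lemma norm_noiseCoeff_le {U : ℝ} (hU : 1 ≤ U) {u : ℝ} (hu : u ∈ Icc (-U) U) (k j : Fin 3) :
    ‖noiseCoeff u k j‖ ≤ 6 * U ^ 2 := by
  have hu' : ‖(u : ℂ)‖ ≤ U := by rw [Complex.norm_real]; exact abs_le.2 hu
  have hI := Complex.norm_I
  have hUU : U ≤ U ^ 2 := by nlinarith
  have h0 := norm_nonneg (u : ℂ)
  have e2 : ‖(2 : ℂ)‖ = 2 := by simp
  fin_cases k <;> fin_cases j <;> simp only [noiseCoeff, Fin.zero_eta, Fin.mk_one,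
    Fin.reduceFinMk, Matrix.cons_val, norm_zero, e2]
  · rw [norm_mul]
    have := norm_sub_le (u : ℂ) Complex.I
    nlinarith
  · positivity
  · positivity
  · have := norm_sub_le (2 * (u : ℂ)) Complex.I
    rw [norm_mul, e2] at this
    nlinarith
  · have := norm_add_le (Complex.I * (u : ℂ) ^ 2) u
    rw [norm_mul, norm_pow, hI] at this
    nlinarith
  · positivity
  · nlinarith
  · have := norm_add_le (2 * Complex.I * (u : ℂ)) 1
    rw [norm_mul, norm_mul, e2, hI, norm_one] at this
    rw [norm_mul, e2]
    nlinarith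
  · rw [norm_mul]
    have := norm_sub_le Complex.I (u : ℂ)
    nlinarith

lemma continuous_noiseCoeff (k j : Fin 3) : Continuous fun u => noiseCoeff u k j := by
  fin_cases k <;> fin_cases j <;> simp only [noiseCoeff, Fin.zero_eta, Fin.mk_one,
    Fin.reduceFinMk, Matrix.cons_val] <;> fun_prop

lemma aestronglyMeasurable_errorIntegrand (hρ : AEMeasurable ρ volume) (k : Fin 3) (u : ℝ) :
    AEStronglyMeasurable (errorIntegrand ρ k u) volume :=
  Finset.aestronglyMeasurable_fun_sum _ fun j _ =>
    (aestronglyMeasurable_momentIntegrand hρ j u).const_mul _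

lemma norm_sq_errorIntegrand_le (hm : 4 ≤ m) {U : ℝ} (hU : 1 ≤ U) {u : ℝ} (hu : u ∈ Icc (-U) U)
    (k : Fin 3) (x : ℝ) :
    ‖errorIntegrand ρ k u x‖ ^ 2 ≤ (18 * U ^ 2) ^ 2 * noiseWeight m ρ x := by
  have hw := noiseWeight_nonneg m ρ x
  have h1 : ‖errorIntegrand ρ k u x‖ ≤ ∑ _j : Fin 3, 6 * U ^ 2 * √(noiseWeight m ρ x) := by
    refine norm_sum_le_of_le _ fun j _ => ?_
    rw [norm_mul]
    gcongr
    · exact norm_noiseCoeff_le hU hu k j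
    · exact Real.le_sqrt_of_sq_le (by simpa using norm_sq_momentIntegrand_le hm j u x)
  rw [Finset.sum_const, Finset.card_univ, Fintype.card_fin, nsmul_eq_mul] at h1
  calc _ ≤ (((3 : ℕ) : ℝ) * (6 * U ^ 2 * √(noiseWeight m ρ x))) ^ 2 := by gcongr
    _ = (18 * U ^ 2) ^ 2 * (√(noiseWeight m ρ x)) ^ 2 := by push_cast; ring
    _ = _ := by rw [Real.sq_sqrt hw]

end Moments

section ErrorBounds

variable {Ω : Type*} [MeasurableSpace Ω] {P : Measure Ω} {W : ℝ → Ω → ℝ} {ρ : ℝ → ℝ} {m : ℝ}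

/-- A family of Wiener integrals is `L²(P)`-differentiable if the integrands are
`L²(ℝ)`-differentiable. -/
lemma hasL2Deriv_of_isWienerIntegral (hW : IsTwoSidedBrownianMotion P W) {F F' : ℝ → ℝ → ℂ}
    {X Y : ℝ → Ω → ℂ} (c : ℂ) (hX : ∀ u, IsWienerIntegral P W (fun x => c * F u x) (X u))
    (hY : ∀ u, IsWienerIntegral P W (fun x => c * F' u x) (Y u))
    (h : ∀ u, Tendsto (fun h : ℝ => eLpNorm (fun x => (F (u + h) x - F u x) / (h : ℂ) - F' u x)
      2 volume) (𝓝[≠] 0) (𝓝 0)) : HasL2Deriv P X Y := by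
  refine fun u => ⟨(hX u).2.1, (hY u).2.1, ?_⟩
  have hc := ENNReal.Tendsto.const_mul (a := ‖c‖ₑ) (h u) (.inr (by simp))
  rw [mul_zero] at hc
  refine hc.congr fun t => ?_
  rw [← eLpNorm_const_smul]
  have hJ := ((((hX (u + t)).sub hW (hX u)).const_mul (t : ℂ)⁻¹).sub hW (hY u)).eLpNorm_eq hW
  refine Eq.trans ?_ (hJ.symm.trans ?_)
  · congr 1
    ext x
    simp only [Pi.smul_apply, Pi.sub_apply, smul_eq_mul]
    ring
  · congr 1
    ext ω
    simp only [Pi.sub_apply]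
    ring

lemma memLp_momentIntegrand (hρ : AEMeasurable ρ volume) (hm : 4 ≤ m)
    (hint : Integrable (noiseWeight m ρ)) (j : Fin 3) (u : ℝ) :
    MemLp (momentIntegrand ρ j u) 2 volume :=
  memLp_two_of_norm_sq_le hint (aestronglyMeasurable_momentIntegrand hρ j u)
    (norm_sq_momentIntegrand_le hm j u)

lemma memLp_noiseIntegrand (hρ : AEMeasurable ρ volume) (hm : 4 ≤ m)
    (hint : Integrable (noiseWeight m ρ)) (k : Fin 3) (u : ℝ) :
    MemLp (noiseIntegrand ρ k u) 2 volume := by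
  have hE : MemLp (errorIntegrand ρ k u) 2 volume :=
    memLp_finsetSum _ fun j _ => (memLp_momentIntegrand hρ hm hint j u).const_mul _
  by_cases hk : k = 0
  · subst hk
    convert! memLp_momentIntegrand hρ hm hint 0 u using 1
  · convert! hE using 1
    ext x
    simp [errorIntegrand_eq, hk]

lemma isWienerIntegral_errorProcess (hW : IsTwoSidedBrownianMotion P W)
    (hρ : AEMeasurable ρ volume) (hm : 4 ≤ m) (hint : Integrable (noiseWeight m ρ)) (n : ℕ)
    (k : Fin 3) (u : ℝ) :
    IsWienerIntegral P W
      (fun x => (((n : ℝ) ^ (-(1 / 2) : ℝ) : ℝ) : ℂ) * errorIntegrand ρ k u x)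
      (errorProcess P W ρ n k u) := by
  have := (isWienerIntegral_wienerIntegral hW (memLp_noiseIntegrand hρ hm hint k u)).const_mul
    ((((n : ℝ) ^ (-(1 / 2) : ℝ) : ℝ) : ℂ) * (if k = 0 then u * (u - Complex.I) else 1))
  convert! this using 1
  ext x
  rw [errorIntegrand_eq, mul_assoc]

lemma errorProcess_ae_eq_sum (hW : IsTwoSidedBrownianMotion P W)
    (hρ : AEMeasurable ρ volume) (hm : 4 ≤ m) (hint : Integrable (noiseWeight m ρ)) (n : ℕ)
    (k : Fin 3) (u : ℝ) :
    errorProcess P W ρ n k u =ᵐ[P] fun ω => (((n : ℝ) ^ (-(1 / 2) : ℝ) : ℝ) : ℂ) *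
      ∑ j, noiseCoeff u k j * wienerIntegral P W (momentIntegrand ρ j u) ω := by
  have hZ := fun j => (isWienerIntegral_wienerIntegral hW
    (memLp_momentIntegrand hρ hm hint j u)).const_mul (noiseCoeff u k j)
  have hs := ((((hZ 0).add hW (hZ 1)).add hW (hZ 2)).const_mul
    (((n : ℝ) ^ (-(1 / 2) : ℝ) : ℝ) : ℂ))
  refine (isWienerIntegral_errorProcess hW hρ hm hint n k u).ae_eq hW ?_
  convert! hs using 1
  · ext x; simp [errorIntegrand, Fin.sum_univ_three]
  · ext ω; simp [Fin.sum_univ_three]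

lemma tendsto_eLpNorm_slope_errorIntegrand (hρ : AEMeasurable ρ volume) (hm : 4 ≤ m)
    (hint : Integrable (noiseWeight m ρ)) {k l : Fin 3}
    (hd : ∀ u x, HasDerivAt (fun v => errorIntegrand ρ k v x) (errorIntegrand ρ l u x) u) (u : ℝ) :
    Tendsto (fun h : ℝ => eLpNorm (fun x => (errorIntegrand ρ k (u + h) x -
      errorIntegrand ρ k u x) / (h : ℂ) - errorIntegrand ρ l u x) 2 volume) (𝓝[≠] 0) (𝓝 0) := by
  refine tendsto_eLpNorm_slope_sub hint (aestronglyMeasurable_errorIntegrand hρ k)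
    (aestronglyMeasurable_errorIntegrand hρ l) hd (C := (18 * (|u| + 1) ^ 2) ^ 2) fun v hv x => ?_
  refine norm_sq_errorIntegrand_le hm (by linarith [abs_nonneg u]) ?_ l x
  constructor
  · linarith [hv.1, neg_abs_le u]
  · linarith [hv.2, le_abs_self u]

lemma hasL2Deriv_errorProcess (hW : IsTwoSidedBrownianMotion P W) (hρ : AEMeasurable ρ volume)
    (hm : 4 ≤ m) (hint : Integrable (noiseWeight m ρ)) (n : ℕ) {k l : Fin 3}
    (hd : ∀ u x, HasDerivAt (fun v => errorIntegrand ρ k v x) (errorIntegrand ρ l u x) u) :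
    HasL2Deriv P (errorProcess P W ρ n k) (errorProcess P W ρ n l) :=
  hasL2Deriv_of_isWienerIntegral hW _ (isWienerIntegral_errorProcess hW hρ hm hint n k)
    (isWienerIntegral_errorProcess hW hρ hm hint n l)
    (tendsto_eLpNorm_slope_errorIntegrand hρ hm hint hd)

/-- Hölder exponent of the moment processes. -/
noncomputable def momentExponent (m : ℝ) : ℝ := min 1 ((m - 4) / 2)

/-- Scale of the moment processes and of their increments. -/
noncomputable def momentScale (m : ℝ) (ρ : ℝ → ℝ) : ℝ := 2 * √(∫ x, noiseWeight m ρ x) + 1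

lemma exists_continuous_version_moment [IsProbabilityMeasure P]
    (hW : IsTwoSidedBrownianMotion P W) (hρ : AEMeasurable ρ volume) (hm : 4 < m)
    (hint : Integrable (noiseWeight m ρ)) (j : Fin 3) :
    ∃ Ψ : ℝ → Ω → ℂ, (∀ u, Ψ u =ᵐ[P] wienerIntegral P W (momentIntegrand ρ j u)) ∧
      (∀ ω, Continuous fun u => Ψ u ω) ∧
      ∀ N : ℕ, 1 ≤ N → ∫⁻ ω, ⨆ u ∈ Icc (-N : ℝ) N, ‖Ψ u ω‖ₑ ∂P ≤
        ENNReal.ofReal (chainingConst (momentScale m ρ) (momentExponent m) *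
          √(3 + Real.log N)) := by
  have hZ := fun u => isWienerIntegral_wienerIntegral hW
    (memLp_momentIntegrand hρ hm.le hint j u)
  have hA : 0 ≤ √(∫ x, noiseWeight m ρ x) := Real.sqrt_nonneg _
  have hγ : 0 < momentExponent m := lt_min one_pos (by linarith)
  have hγ1 : momentExponent m ≤ 1 := min_le_left _ _
  have hγm : 2 * momentExponent m + 4 ≤ m := by
    have : momentExponent m ≤ (m - 4) / 2 := min_le_right _ _
    linarith
  refine exists_continuous_version (fun u => (hZ u).2.1.aestronglyMeasurable.aemeasurable)
    (by unfold momentScale; positivity) hγ (fun u v => ?_) fun u => ?_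
  · refine (((hZ u).sub hW (hZ v)).hasSubgaussianNorm hW).mono ENNReal.toReal_nonneg ?_
    refine (toReal_eLpNorm_two_le_of_norm_sq_le hint (noiseWeight_nonneg m ρ) (by positivity)
      (norm_sq_momentIntegrand_sub_le hγ hγ1 hγm j u v)).trans ?_
    have : 0 ≤ |u - v| ^ momentExponent m := by positivity
    rw [momentScale]
    nlinarith
  · refine ((hZ u).hasSubgaussianNorm hW).mono ENNReal.toReal_nonneg ?_
    refine (toReal_eLpNorm_two_le_of_norm_sq_le hint (noiseWeight_nonneg m ρ) zero_le_one
      (norm_sq_momentIntegrand_le hm.le j u)).trans ?_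
    rw [momentScale]
    linarith

lemma sqrt_log_natCeil_le {U₀ U : ℝ} (hU₀ : 1 < U₀) (hU : U₀ ≤ U) :
    √(3 + Real.log ⌈U⌉₊) ≤ √(4 / Real.log U₀ + 1) * √(Real.log U) := by
  have hl0 : 0 < Real.log U₀ := Real.log_pos hU₀
  have hl : Real.log U₀ ≤ Real.log U := Real.log_le_log (by linarith) hU
  have hceil : (⌈U⌉₊ : ℝ) ≤ 2 * U := by linarith [Nat.ceil_lt_add_one (by linarith : 0 ≤ U)]
  have hpos : (0 : ℝ) < ⌈U⌉₊ := by
    exact_mod_cast Nat.ceil_pos.2 (by linarith)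
  have h1 : Real.log ⌈U⌉₊ ≤ 1 + Real.log U := by
    refine (Real.log_le_log hpos hceil).trans ?_
    rw [Real.log_mul (by norm_num) (by linarith)]
    linarith [Real.log_two_lt_d9]
  rw [← Real.sqrt_mul (by positivity)]
  refine Real.sqrt_le_sqrt ?_
  have h2 : 4 ≤ 4 / Real.log U₀ * Real.log U := by
    rw [div_mul_eq_mul_div, le_div_iff₀ hl0]
    linarith
  linarith

lemma lintegral_biSup_sum_le [IsProbabilityMeasure P] {Ψ : Fin 3 → ℝ → Ω → ℂ}
    (hm : ∀ j u, AEMeasurable (Ψ j u) P) (hc : ∀ j ω, Continuous fun u => Ψ j u ω)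
    {c B : ℝ} (hc0 : 0 ≤ c) {U : ℝ} (hU : 1 ≤ U) (k : Fin 3)
    (hB : ∀ j, ∫⁻ ω, ⨆ u ∈ Icc (-(⌈U⌉₊ : ℝ)) ⌈U⌉₊, ‖Ψ j u ω‖ₑ ∂P ≤ ENNReal.ofReal B) :
    ∫⁻ ω, ⨆ u ∈ Icc (-U) U, ‖(c : ℂ) * ∑ j, noiseCoeff u k j * Ψ j u ω‖ₑ ∂P ≤
      ENNReal.ofReal (18 * c * U ^ 2 * B) := by
  have hUN : U ≤ ⌈U⌉₊ := Nat.le_ceil U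
  calc ∫⁻ ω, ⨆ u ∈ Icc (-U) U, ‖(c : ℂ) * ∑ j, noiseCoeff u k j * Ψ j u ω‖ₑ ∂P
      ≤ ∫⁻ ω, ENNReal.ofReal (c * (6 * U ^ 2)) *
          ∑ j, ⨆ u ∈ Icc (-(⌈U⌉₊ : ℝ)) ⌈U⌉₊, ‖Ψ j u ω‖ₑ ∂P := by
        refine lintegral_mono fun ω => iSup₂_le fun u hu => ?_
        have hu' : u ∈ Icc (-(⌈U⌉₊ : ℝ)) ⌈U⌉₊ := ⟨by linarith [hu.1], by linarith [hu.2]⟩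
        rw [enorm_mul, ENNReal.ofReal_mul hc0, mul_assoc, Finset.mul_sum]
        refine mul_le_mul' (le_of_eq ?_) ((enorm_sum_le _ _).trans
          (Finset.sum_le_sum fun j _ => ?_))
        · rw [← ofReal_norm, Complex.norm_real, Real.norm_of_nonneg hc0]
        · rw [enorm_mul]
          refine mul_le_mul' ?_ (le_iSup₂ (f := fun (u : ℝ)
            (_ : u ∈ Icc (-(⌈U⌉₊ : ℝ)) ⌈U⌉₊) => ‖Ψ j u ω‖ₑ) u hu')
          rw [← ofReal_norm]
          exact ENNReal.ofReal_le_ofReal (norm_noiseCoeff_le hU hu k j)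
    _ = ENNReal.ofReal (c * (6 * U ^ 2)) *
          ∑ j, ∫⁻ ω, ⨆ u ∈ Icc (-(⌈U⌉₊ : ℝ)) ⌈U⌉₊, ‖Ψ j u ω‖ₑ ∂P := by
        rw [lintegral_const_mul' _ _ ENNReal.ofReal_ne_top, lintegral_finsetSum' _ fun j _ =>
          aemeasurable_biSup_enorm_of_continuous (hm j) (hc j) (by positivity)]
    _ ≤ ENNReal.ofReal (c * (6 * U ^ 2)) * ∑ _j : Fin 3, ENNReal.ofReal B := by
        gcongr with j
        exact hB j
    _ = ENNReal.ofReal (18 * c * U ^ 2 * B) := by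
        rw [Finset.sum_const, Finset.card_univ, Fintype.card_fin, nsmul_eq_mul,
          ← ENNReal.ofReal_natCast, ← ENNReal.ofReal_mul (by positivity),
          ← ENNReal.ofReal_mul (by positivity)]
        congr 1
        push_cast
        ring

end ErrorBounds

theorem mainTheorem7 (ρ : ℝ → ℝ) (hρ : AEMeasurable ρ volume) (m : ℝ) (hm : 4 < m)
    (hint : Integrable (fun x : ℝ => (1 + |x|) ^ m * Real.exp (-2 * x) * ρ x ^ 2) volume) :
    ∃ C : ℝ → ℝ, ∀ {Ω : Type*} [MeasurableSpace Ω] (P : Measure Ω) [IsProbabilityMeasure P]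
      (W : ℝ → Ω → ℝ), IsTwoSidedBrownianMotion P W →
      -- the Wiener integrals defining the processes exist
      (∀ (k : Fin 3) (u : ℝ), IsWienerIntegral P W (noiseIntegrand ρ k u)
        (wienerIntegral P W (noiseIntegrand ρ k u))) ∧
      ∀ n : ℕ, 1 ≤ n →
        HasL2Deriv P (errorProcess P W ρ n 0) (errorProcess P W ρ n 1) ∧
        HasL2Deriv P (errorProcess P W ρ n 1) (errorProcess P W ρ n 2) ∧
        ∀ k : Fin 3, ∃ Ψ : ℝ → Ω → ℂ,
          (∀ u, Ψ u =ᵐ[P] errorProcess P W ρ n k u) ∧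
          (∀ᵐ ω ∂P, Continuous fun u => Ψ u ω) ∧
          ∀ U : ℝ, 0 < U →
            AEMeasurable (fun ω => ⨆ u ∈ Icc (-U) U, ‖Ψ u ω‖ₑ) P ∧
            ∀ U₀ : ℝ, 1 < U₀ → U₀ ≤ U →
              ∫⁻ ω, (⨆ u ∈ Icc (-U) U, ‖Ψ u ω‖ₑ) ∂P ≤
                ENNReal.ofReal
                  (C U₀ * (n : ℝ) ^ (-(1 / 2) : ℝ) * U ^ 2 * Real.sqrt (Real.log U)) := by
  change Integrable (noiseWeight m ρ) volume at hint
  set κ := chainingConst (momentScale m ρ) (momentExponent m) with hκ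
  have hκ0 : 0 ≤ κ := by
    have : 0 ≤ ∑' k : ℕ, ((k : ℝ) + 1) * ((2 : ℝ) ^ (-momentExponent m)) ^ k :=
      tsum_nonneg fun k => by positivity
    rw [hκ, chainingConst, momentScale]
    positivity
  refine ⟨fun U₀ => 18 * κ * √(4 / Real.log U₀ + 1), ?_⟩
  intro Ω _ P _ W hW
  refine ⟨fun k u => isWienerIntegral_wienerIntegral hW
    (memLp_noiseIntegrand hρ hm.le hint k u), fun n hn => ⟨?_, ?_, fun k => ?_⟩⟩
  · exact hasL2Deriv_errorProcess hW hρ hm.le hint n fun u x => hasDerivAt_errorIntegrand_zero u x ρ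
  · exact hasL2Deriv_errorProcess hW hρ hm.le hint n fun u x => hasDerivAt_errorIntegrand_one u x ρ
  choose Ψ hae hcont hsup using exists_continuous_version_moment hW hρ hm hint
  set c := (n : ℝ) ^ (-(1 / 2) : ℝ) with hc
  have hc0 : 0 ≤ c := by positivity
  have hΨm : ∀ j u, AEMeasurable (Ψ j u) P := fun j u =>
    ((isWienerIntegral_wienerIntegral hW
      (memLp_momentIntegrand hρ hm.le hint j u)).2.1.aestronglyMeasurable.aemeasurable).congr
      (hae j u).symm
  have hcontΨ : ∀ ω, Continuous fun u => (c : ℂ) * ∑ j, noiseCoeff u k j * Ψ j u ω := fun ω =>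
    continuous_const.mul (continuous_finsetSum _ fun j _ =>
      (continuous_noiseCoeff k j).mul (hcont j ω))
  refine ⟨fun u ω => (c : ℂ) * ∑ j, noiseCoeff u k j * Ψ j u ω, fun u => ?_,
    .of_forall hcontΨ, fun U hU => ⟨?_, fun U₀ hU₀ hUU => ?_⟩⟩
  · refine EventuallyEq.trans ?_ (errorProcess_ae_eq_sum hW hρ hm.le hint n k u).symm
    filter_upwards [ae_all_iff.2 fun j => hae j u] with ω hω
    simp_rw [hω]
    rfl
  · refine aemeasurable_biSup_enorm_of_continuous (fun u => ?_) hcontΨ hU.le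
    have := fun j => hΨm j u
    fun_prop
  · have hU1 : 1 ≤ U := by linarith
    refine (lintegral_biSup_sum_le hΨm hcont hc0 hU1 k fun j =>
      hsup j ⌈U⌉₊ (Nat.ceil_pos.2 hU)).trans (ENNReal.ofReal_le_ofReal ?_)
    have := sqrt_log_natCeil_le hU₀ hUU
    calc 18 * c * U ^ 2 * (κ * √(3 + Real.log ⌈U⌉₊))
        ≤ 18 * c * U ^ 2 * (κ * (√(4 / Real.log U₀ + 1) * √(Real.log U))) := by gcongr
      _ = _ := by ring
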